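/- All graphs are simple and undirected, and graphs are considered up to isomorphism. For a finite set $\Sigma$ of unary relation symbols, a $\Sigma$-expansion $G^+$ of a graph $G$ is obtained by interpreting every symbol of $\Sigma$ as a set of vertices of $G$. A non-copying transduction $\mathsf T$ consists of a finite set $\Sigma$ of unary relation symbols and two first-order formulas $\nu(x)$, $\eta(x,y)$ in the language of $\Sigma$-expanded graphs (adjacency and the symbols of $\Sigma$), where $\eta$ is symmetric and anti-reflexive on all $\Sigma$-expanded graphs; a graph $H$ is a $\mathsf T$-transduction of a graph $G$ if, for some $\Sigma$-expansion $G^+$ of $G$, $H$ is the graph with vertex set $\{v : G^+\models\nu(v)\}$ in which $u,v$ are adjacent if and only if $G^+\models\eta(u,v)$. For $k\ge 1$, the $k$-copy operation maps $G$ to the graph obtained from $k$ disjoint copies of $G$ by making the copies of each vertex pairwise adjacent. A transduction is any composition of copy operations and non-copying transductions. A class $\mathcal C$ is a transduction of a class $\mathcal D$, written $\mathcal C\sqsubseteq_{\mathrm{FO}}\mathcal D$, if there is a single transduction $\mathsf T$ such that every graph in $\mathcal C$ is a $\mathsf T$-transduction of some graph in $\mathcal D$. Let $\mathcal G$ be the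 class of all finite graphs, $\mathcal{TP}$ the class of trivially perfect graphs (comparability graphs of finite rooted trees: two distinct nodes are adjacent if and only if one is an ancestor of the other), and $\mathcal H$ the class of half-graphs (vertices $a_1,\dots,a_n,b_1,\dots,b_n$ and edges $a_ib_j$ for $i\le j$). A class $\mathcal C$ is monadically dependent if $\mathcal G\not\sqsubseteq_{\mathrm{FO}}\mathcal C$, monadically straight if $\mathcal{TP}\not\sqsubseteq_{\mathrm{FO}}\mathcal C$, and monadically stable if $\mathcal H\not\sqsubseteq_{\mathrm{FO}}\mathcal C$. For an integer $r\ge 0$, let $\mathcal B_r(\mathcal C)$ be the class of all balls $B_r^G(v)$ with $G\in\mathcal C$ and $v\in V(G)$, where $B_r^G(v)$ is the subgraph of $G$ induced by the vertices at distance at most $r$ from $v$. The class $\mathcal C$ is locally monadically dependent (respectively straight, stable) if $\mathcal B_r(\mathcal C)$ is monadically dependent (respectively straight, stable) for every integer $r\ge 0$. **Theorem.** For every class $\mathcal C$ of (finite or infinite) graphs: 1. $\mathcal C$ is locally monadically dependent if and only if $\mathcal C$ is monadically dependent; 2. $\mathcal C$ is locally monadically straight if and only if $\mathcal C$ is monadically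 straight; 3. $\mathcal C$ is locally monadically stable if and only if $\mathcal C$ is monadically stable. -/

import Mathlib

universe u

namespace GraphTransduction

open FirstOrder

/-! ### Expanded graphs and first-order formulas on them -/

/-- Relation symbols of the language of `S`-expanded graphs: the binary adjacency symbol, and one
unary symbol for each element of `S`. -/
inductive ExpandedRel (S : Type) : ℕ → Type
  | adj : ExpandedRel S 2
  | color (c : S) : ExpandedRel S 1

/-- The language of `S`-expanded graphs. -/
def expandedLanguage (S : Type) : Language := ⟨fun _ => Empty, ExpandedRel S⟩

/-- The first-order structure of the `S`-expansion of the graph `G` in which the unary symbol `c`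
is interpreted as the set `P c` of vertices. -/
@[reducible] def expandedStructure {S : Type} {V : Type u} (G : SimpleGraph V) (P : S → Set V) :
    (expandedLanguage S).Structure V where
  funMap := fun f => nomatch f
  RelMap := fun
    | .adj => fun x => G.Adj (x 0) (x 1)
    | .color c => fun x => x 0 ∈ P c

/-- The formula `φ` holds at the assignment `v` in the `S`-expansion `(G, P)`. -/
def Holds {S : Type} {V : Type u} (G : SimpleGraph V) (P : S → Set V) {α : Type}
    (φ : (expandedLanguage S).Formula α) (v : α → V) : Prop :=
  letI := expandedStructure G P
  φ.Realize v

/-! ### Transductions -/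

/-- A non-copying transduction: a finite set `S` of unary relation symbols and a simple
interpretation `(ν(x), η(x,y))` of graphs in `S`-expanded graphs, where `η` is symmetric and
anti-reflexive on all `S`-expanded graphs. -/
structure NonCopyingTransduction where
  /-- The set of unary relation symbols. -/
  S : Type
  finite_S : Finite S
  /-- The formula that defines the vertex set. -/
  ν : (expandedLanguage S).Formula (Fin 1)
  /-- The formula that defines the adjacency. -/
  η : (expandedLanguage S).Formula (Fin 2)
  symmetric : ∀ {V : Type u} (G : SimpleGraph V) (P : S → Set V) (x y : V),
    Holds G P η ![x, y] ↔ Holds G P η ![y, x]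
  antireflexive : ∀ {V : Type u} (G : SimpleGraph V) (P : S → Set V) (x y : V),
    Holds G P η ![x, y] → x ≠ y

/-- The graph that the simple interpretation of `T` defines in the expanded graph `(G, P)`. -/
def NonCopyingTransduction.interpret (T : NonCopyingTransduction.{u}) {V : Type u}
    (G : SimpleGraph V) (P : T.S → Set V) : SimpleGraph {v : V // Holds G P T.ν ![v]} where
  Adj x y := Holds G P T.η ![x.1, y.1]
  symm := ⟨fun x y h => (T.symmetric G P x.1 y.1).1 h⟩
  loopless := ⟨fun x h => T.antireflexive G P x.1 x.1 h rfl⟩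

/-- The graph made of `k` copies of `G`, with the copies of each vertex made pairwise adjacent. -/
def copyGraph (k : ℕ) {V : Type u} (G : SimpleGraph V) : SimpleGraph (V × Fin k) :=
  G.boxProd (⊤ : SimpleGraph (Fin k))

/-- Transductions: compositions of copy operations and non-copying transductions. -/
inductive Transduction : Type 1
  | nonCopying (T : NonCopyingTransduction.{u}) : Transduction
  | copy (k : ℕ) (hk : 0 < k) : Transduction
  | comp (T₁ T₂ : Transduction) : Transduction

/-- `T.Produces G H`: the graph `H` is (up to isomorphism) a `T`-transduction of the graph `G`.
In `comp T₁ T₂`, the transduction `T₁` is applied first. -/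
def Transduction.Produces : Transduction.{u} →
    ∀ {V W : Type u}, SimpleGraph V → SimpleGraph W → Prop
  | .nonCopying T, V, _, G, H => ∃ P : T.S → Set V, Nonempty (T.interpret G P ≃g H)
  | .copy k _, _, _, G, H => Nonempty (copyGraph k G ≃g H)
  | .comp T₁ T₂, _, _, G, H => ∃ (U : Type u) (K : SimpleGraph U), T₁.Produces G K ∧ T₂.Produces K H

/-- A class of graphs. -/
abbrev GraphClass := ∀ V : Type u, SimpleGraph V → Prop

/-- `C` is a transduction of `D`: there is one transduction `T` such that every graph in `C` is a
`T`-transduction of some graph in `D`. -/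
def IsTransductionOf (C D : GraphClass.{u}) : Prop :=
  ∃ T : Transduction.{u}, ∀ (W : Type u) (H : SimpleGraph W), C W H →
    ∃ (V : Type u) (G : SimpleGraph V), D V G ∧ T.Produces G H

/-! ### Three classes of graphs -/

/-- The class of all finite graphs. -/
def finiteGraphs : GraphClass.{u} := fun V _ => Finite V

/-- The class of trivially perfect graphs: comparability graphs of finite rooted trees, where two
distinct nodes are adjacent if one of them is an ancestor of the other. -/
def triviallyPerfectGraphs : GraphClass.{u} := fun _ G =>
  ∃ t : RootedTree.{u}, Finite t ∧ Nonempty (G ≃g SimpleGraph.fromRel (fun x y : t => x ≤ y))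

/-- The half-graph with vertices `a_1, …, a_n` (left) and `b_1, …, b_n` (right), and with an edge
between `a_i` and `b_j` whenever `i ≤ j`. -/
def halfGraph (n : ℕ) : SimpleGraph (Fin n ⊕ Fin n) :=
  SimpleGraph.fromRel fun x y => ∃ i j : Fin n, x = Sum.inl i ∧ y = Sum.inr j ∧ i ≤ j

/-- The class of half-graphs. -/
def halfGraphs : GraphClass.{u} := fun _ G => ∃ n : ℕ, Nonempty (G ≃g halfGraph n)

/-! ### Monadic properties and their local versions -/

/-- The class `C` does not transduce the class of all finite graphs. -/
def MonadicallyDependent (C : GraphClass.{u}) : Prop := ¬ IsTransductionOf finiteGraphs C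

/-- The class `C` does not transduce the class of trivially perfect graphs. -/
def MonadicallyStraight (C : GraphClass.{u}) : Prop := ¬ IsTransductionOf triviallyPerfectGraphs C

/-- The class `C` does not transduce the class of half-graphs. -/
def MonadicallyStable (C : GraphClass.{u}) : Prop := ¬ IsTransductionOf halfGraphs C

/-- The subgraph of `G` induced by the vertices at distance at most `r` from `v`. -/
def closedBall {V : Type u} (G : SimpleGraph V) (r : ℕ) (v : V) :
    SimpleGraph {w : V // G.edist v w ≤ (r : ℕ∞)} :=
  G.comap Subtype.val

/-- The class of all balls of radius `r` of graphs in `C`, up to isomorphism. -/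
def ballClass (r : ℕ) (C : GraphClass.{u}) : GraphClass.{u} := fun _ H =>
  ∃ (V : Type u) (G : SimpleGraph V) (v : V), C V G ∧ Nonempty (H ≃g closedBall G r v)

/-- All classes of `r`-balls of `C` are monadically dependent. -/
def LocallyMonadicallyDependent (C : GraphClass.{u}) : Prop :=
  ∀ r : ℕ, MonadicallyDependent (ballClass r C)

/-- All classes of `r`-balls of `C` are monadically straight. -/
def LocallyMonadicallyStraight (C : GraphClass.{u}) : Prop :=
  ∀ r : ℕ, MonadicallyStraight (ballClass r C)

/-- All classes of `r`-balls of `C` are monadically stable. -/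
def LocallyMonadicallyStable (C : GraphClass.{u}) : Prop :=
  ∀ r : ℕ, MonadicallyStable (ballClass r C)

end GraphTransduction

/-!
That a class of balls of `C` is a transduction of `C` is clear, since balls are induced subgraphs.
So let `X` be one of the three classes of graphs, and suppose that `X` is a transduction of `C`.
It has to be a transduction of a class of balls of `C` of bounded radius.

**Normal form.** Every transduction is subsumed by a `Scheme`, which copies the graph once and
then applies one formula for each pair of copies, and conversely (`Transduction.exists_scheme`,
`Scheme.exists_transduction`). Hence the vertices of a graph `H` that is obtained from `G` lie at
vertices of `G`, and `H` inherits a distance from `G`.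

**Locality.** Cut `G` into a near part, a far part, and a buffer between them. By `locality`,
tuples in the near part that agree on finitely many formulas in the subgraph induced by the near
part and the buffer are not distinguished by a formula on `G`, even with parameters in the far
part. Since the far part is fixed in the game that proves this, no version of Gaifman's theorem is
needed. There are two consequences.

* If the near part is around `N` vertices of `H`, where `N` exceeds the number of types, then two
  of these vertices have the same neighbours in the far part. So every vertex of `H` that
  distinguishes them is near one of the `N` vertices (`Scheme.exists_distinguishes_near`). A
  distance with this property is called concentrated (`IsConcentrated`).
* If the near part is a ball, then the part of `H` inside of it is obtained through a scheme from
  a larger ball (`Scheme.exists_closedBall_produces`).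

**Ramsey arguments.** It remains to show that each graph of `X`, or of a class of which `X` is a
transduction, embeds in a larger graph of `X`, inside of a ball of bounded radius, whatever the
concentrated distance is. In each case, `N` vertices are chosen such that any two of them are
distinguished by a large part of the graph. This part is then coloured with `N` colours according
to which of the `N` vertices is near, and the graph is found in one colour. For trivially perfect
graphs, the `N` vertices form a chain in a complete tree, and complete trees have a Ramsey
property for colourings of the nodes (`exists_monochromatic_words`). For half-graphs, the `N`
vertices are on one side and the coloured vertices are on the other side, so that the argument is
applied twice, with the sides exchanged the second time (`exists_halfGraph_near`). All finite
graphs are a transduction of the powerset graphs, and these are treated as the half-graphs, with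
`exists_color_shatters` in place of the pigeonhole principle.
-/

namespace GraphTransduction

open FirstOrder

/-! ### Definable relations on expanded graphs -/

/-- An `n`-ary relation on the vertices of each `S`-expanded graph. -/
abbrev RelFamily (S : Type) (n : ℕ) : Type (u + 1) :=
  ∀ V : Type u, SimpleGraph V → (S → Set V) → (Fin n → V) → Prop

/-- The family `R` is defined by one first-order formula on all expanded graphs. -/
def IsDefinable {S : Type} {n : ℕ} (R : RelFamily.{u} S n) : Prop :=
  ∃ φ : (expandedLanguage S).Formula (Fin n),
    ∀ (V : Type u) (G : SimpleGraph V) (P : S → Set V) (x : Fin n → V),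
      Holds G P φ x ↔ R V G P x

namespace IsDefinable

variable {S : Type} {n : ℕ}

theorem holds (φ : (expandedLanguage S).Formula (Fin n)) :
    IsDefinable.{u} fun _ G P x => Holds G P φ x :=
  ⟨φ, fun _ _ _ _ => Iff.rfl⟩

theorem congr {R R' : RelFamily.{u} S n} (h : IsDefinable R)
    (hR : ∀ V G P x, R V G P x ↔ R' V G P x) : IsDefinable R' := by
  obtain ⟨φ, hφ⟩ := h
  exact ⟨φ, fun V G P x => (hφ V G P x).trans (hR V G P x)⟩

theorem false : IsDefinable.{u} (S := S) (n := n) fun _ _ _ _ => False :=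
  ⟨⊥, fun _ _ _ _ => Iff.rfl⟩

theorem imp {R R' : RelFamily.{u} S n} (h : IsDefinable R) (h' : IsDefinable R') :
    IsDefinable fun V G P x => R V G P x → R' V G P x := by
  obtain ⟨φ, hφ⟩ := h
  obtain ⟨ψ, hψ⟩ := h'
  refine ⟨φ.imp ψ, fun V G P x => ?_⟩
  change (Holds G P φ x → Holds G P ψ x) ↔ (R V G P x → R' V G P x)
  rw [hφ, hψ]

theorem not {R : RelFamily.{u} S n} (h : IsDefinable R) :
    IsDefinable fun V G P x => ¬ R V G P x :=
  h.imp .false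

theorem and {R R' : RelFamily.{u} S n} (h : IsDefinable R) (h' : IsDefinable R') :
    IsDefinable fun V G P x => R V G P x ∧ R' V G P x :=
  (h.imp h'.not).not.congr fun _ _ _ _ => by tauto

theorem or {R R' : RelFamily.{u} S n} (h : IsDefinable R) (h' : IsDefinable R') :
    IsDefinable fun V G P x => R V G P x ∨ R' V G P x :=
  (h.not.imp h').congr fun _ _ _ _ => by tauto

theorem eq (i j : Fin n) : IsDefinable.{u} (S := S) fun _ _ _ x => x i = x j :=
  ⟨(Language.Term.var i).equal (Language.Term.var j), fun V G P x => by
    let _ := expandedStructure G P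
    exact Language.Formula.realize_equal⟩

theorem adj (i j : Fin n) : IsDefinable.{u} (S := S) fun _ G _ x => G.Adj (x i) (x j) :=
  ⟨Language.Relations.formula₂ (L := expandedLanguage S) (ExpandedRel.adj)
      (Language.Term.var i) (Language.Term.var j), fun V G P x => by
    let _ := expandedStructure G P
    exact Language.Formula.realize_rel₂⟩

theorem color (c : S) (i : Fin n) : IsDefinable.{u} fun _ _ P x => x i ∈ P c :=
  ⟨Language.Relations.formula₁ (L := expandedLanguage S) (ExpandedRel.color c)
      (Language.Term.var i), fun V G P x => by
    let _ := expandedStructure G P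
    exact Language.Formula.realize_rel₁⟩

theorem all {R : RelFamily.{u} S (n + 1)} (h : IsDefinable R) :
    IsDefinable fun V G P (x : Fin n → V) => ∀ a : V, R V G P (Fin.snoc x a) := by
  obtain ⟨φ, hφ⟩ := h
  refine ⟨(φ.relabel (Fin.lastCases (motive := fun _ => Fin n ⊕ Unit) (Sum.inr ())
    Sum.inl)).iAlls Unit, fun V G P x => ?_⟩
  let _ := expandedStructure G P
  refine Language.BoundedFormula.realize_iAlls.trans ?_
  have key : ∀ i : Unit → V, (fun a => Sum.elim x i a) ∘ (Fin.lastCases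
      (motive := fun _ => Fin n ⊕ Unit) (Sum.inr ()) Sum.inl) =
      (Fin.snoc x (i ()) : Fin (n + 1) → V) := by
    intro i
    ext j
    refine Fin.lastCases ?_ (fun j => ?_) j <;> simp
  constructor
  · intro h a
    have := h fun _ => a
    rw [Language.Formula.realize_relabel, key] at this
    exact (hφ V G P _).1 this
  · intro h i
    rw [Language.Formula.realize_relabel, key]
    exact (hφ V G P _).2 (h _)

theorem ex {R : RelFamily.{u} S (n + 1)} (h : IsDefinable R) :
    IsDefinable fun V G P (x : Fin n → V) => ∃ a : V, R V G P (Fin.snoc x a) :=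
  h.not.all.not.congr fun _ _ _ _ => by simp

theorem iAll {κ : Type} [Finite κ] {R : κ → RelFamily.{u} S n} (h : ∀ k, IsDefinable (R k)) :
    IsDefinable fun V G P x => ∀ k, R k V G P x := by
  choose φ hφ using h
  refine ⟨Language.Formula.iInf φ, fun V G P x => ?_⟩
  simp only [← hφ]
  let _ := expandedStructure G P
  exact Language.BoundedFormula.realize_iInf

theorem iEx {κ : Type} [Finite κ] {R : κ → RelFamily.{u} S n} (h : ∀ k, IsDefinable (R k)) :
    IsDefinable fun V G P x => ∃ k, R k V G P x :=
  (iAll fun k => (h k).not).not.congr fun _ _ _ _ => by simp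

theorem comp {m : ℕ} {R : RelFamily.{u} S n} (h : IsDefinable R) (f : Fin n → Fin m) :
    IsDefinable fun V G P (x : Fin m → V) => R V G P (fun i => x (f i)) := by
  obtain ⟨φ, hφ⟩ := h
  refine ⟨φ.relabel f, fun V G P x => ?_⟩
  let _ := expandedStructure G P
  exact Language.Formula.realize_relabel.trans (hφ V G P _)

theorem const (p : Prop) : IsDefinable.{u} (S := S) (n := n) fun _ _ _ _ => p := by
  by_cases hp : p
  · exact IsDefinable.false.not.congr fun _ _ _ _ => by simp [hp]
  · exact IsDefinable.false.congr fun _ _ _ _ => by simp [hp]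

end IsDefinable

/-- Induction on first-order formulas, in terms of the relations that they define. The quantifier
binds the last variable. -/
theorem holds_induction {S : Type} {motive : ∀ n, RelFamily.{u} S n → Prop}
    (false : ∀ n, motive n fun _ _ _ _ => False)
    (eq : ∀ n i j, motive n fun _ _ _ x => x i = x j)
    (adj : ∀ n i j, motive n fun _ G _ x => G.Adj (x i) (x j))
    (color : ∀ n c i, motive n fun _ _ P x => x i ∈ P c)
    (imp : ∀ n R R', motive n R → motive n R' → motive n fun V G P x => R V G P x → R' V G P x)
    (all : ∀ n R, motive (n + 1) R → motive n fun V G P x => ∀ a : V, R V G P (Fin.snoc x a))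
    {n : ℕ} (φ : (expandedLanguage S).Formula (Fin n)) :
    motive n fun _ G P x => Holds G P φ x := by
  have var : ∀ {m : ℕ} (t : (expandedLanguage S).Term (Fin n ⊕ Fin m)), ∃ i : Fin (n + m),
      ∀ (V : Type u) (G : SimpleGraph V) (P : S → Set V) (x : Fin (n + m) → V),
        letI := expandedStructure G P
        t.realize (Sum.elim (fun i => x (Fin.castAdd m i)) fun i => x (Fin.natAdd n i)) = x i := by
    intro m t
    cases t with
    | var i =>
      cases i with
      | inl i => exact ⟨Fin.castAdd m i, fun _ _ _ _ => rfl⟩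
      | inr i => exact ⟨Fin.natAdd n i, fun _ _ _ _ => rfl⟩
    | func f _ => exact nomatch f
  have congr : ∀ {m : ℕ} {R R' : RelFamily.{u} S m}, motive m R →
      (∀ V G P x, R V G P x ↔ R' V G P x) → motive m R' := by
    intro m R R' h hR
    have : R = R' := by
      funext V G P x
      exact propext (hR V G P x)
    exact this ▸ h
  have key : ∀ {m : ℕ} (ψ : (expandedLanguage S).BoundedFormula (Fin n) m),
      motive (n + m) fun V G P x =>
        letI := expandedStructure G P
        ψ.Realize (fun i => x (Fin.castAdd m i)) fun i => x (Fin.natAdd n i) := by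
    intro m ψ
    induction ψ with
    | falsum => exact false _
    | equal t₁ t₂ =>
      obtain ⟨i, hi⟩ := var t₁
      obtain ⟨j, hj⟩ := var t₂
      refine congr (eq _ i j) fun V G P x => ?_
      rw [← hi V G P x, ← hj V G P x]
      rfl
    | rel R ts =>
      cases R with
      | adj =>
        obtain ⟨i, hi⟩ := var (ts 0)
        obtain ⟨j, hj⟩ := var (ts 1)
        refine congr (adj _ i j) fun V G P x => ?_
        rw [← hi V G P x, ← hj V G P x]
        rfl
      | color c =>
        obtain ⟨i, hi⟩ := var (ts 0)
        refine congr (color _ c i) fun V G P x => ?_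
        rw [← hi V G P x]
        rfl
    | imp _ _ h₁ h₂ => exact imp _ _ _ h₁ h₂
    | @all m ψ h =>
      refine congr (all _ _ h) fun V G P x => ?_
      let _ := expandedStructure G P
      refine Iff.trans (forall_congr' fun a => ?_) Language.BoundedFormula.realize_all.symm
      have h₁ : ∀ i, (Fin.snoc x a : Fin (n + m + 1) → V) (Fin.castAdd (m + 1) i) =
          x (Fin.castAdd m i) := fun i => Fin.snoc_castSucc (α := fun _ => V) a x (Fin.castAdd m i)
      have h₂ : (fun i => (Fin.snoc x a : Fin (n + m + 1) → V) (Fin.natAdd n i)) =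
          Fin.snoc (fun i => x (Fin.natAdd n i)) a := by
        ext i
        refine Fin.lastCases ?_ (fun i => ?_) i
        · rw [Fin.snoc_last]
          exact Fin.snoc_last (α := fun _ => V) a x
        · rw [Fin.snoc_castSucc]
          exact Fin.snoc_castSucc (α := fun _ => V) a x (Fin.natAdd n i)
      simp only [h₁]
      rw [h₂]
  refine congr (key φ) fun V G P x => ?_
  exact iff_of_eq (congrArg _ (Subsingleton.elim _ _))

theorem IsDefinable.mapColor {S S' : Type} {n : ℕ} {R : RelFamily.{u} S n} (h : IsDefinable R)
    (f : S → S') : IsDefinable fun V G P x => R V G (fun c => P (f c)) x := by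
  obtain ⟨φ, hφ⟩ := h
  refine IsDefinable.congr ?_ fun V G P x => hφ V G _ x
  exact holds_induction
    (motive := fun n R => IsDefinable fun V G (P : S' → Set V) x => R V G (fun c => P (f c)) x)
    (fun _ => .false) (fun _ => .eq) (fun _ => .adj) (fun _ c i => .color (f c) i)
    (fun _ _ _ h h' => h.imp h') (fun _ _ h => h.all) φ

/-! ### Schemes: transductions in normal form -/

/-- A transduction in normal form: copy the graph once, and then define adjacency by one formula for
each pair of copies. No formula for the vertex set is needed, since the vertices of the result may
be any set of copies of vertices. -/
structure Scheme where
  /-- The set of copies. -/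
  ι : Type
  /-- The set of unary relation symbols. -/
  S : Type
  finite_ι : Finite ι
  finite_S : Finite S
  /-- `η i j` defines the adjacency between the `i`-th and the `j`-th copy. -/
  η : ι → ι → (expandedLanguage S).Formula (Fin 2)

namespace Scheme

attribute [instance] finite_ι finite_S

/-- The map `e`, which sends each vertex of `H` to a copy of a vertex of `G`, witnesses that `H` is
obtained through the scheme `I` from the expanded graph `(G, P)`. -/
structure Encodes (I : Scheme) {V W : Type u} (G : SimpleGraph V) (P : I.S → Set V)
    (H : SimpleGraph W) (e : W → V × I.ι) : Prop where
  injective : Function.Injective e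
  adj_iff : ∀ x y, H.Adj x y ↔ Holds G P (I.η (e x).2 (e y).2) ![(e x).1, (e y).1]

/-- The graph `H` is obtained from the graph `G` through the scheme `I`. -/
def Produces (I : Scheme) {V W : Type u} (G : SimpleGraph V) (H : SimpleGraph W) : Prop :=
  ∃ (P : I.S → Set V) (e : W → V × I.ι), I.Encodes G P H e

/-- The unary symbols for which an expansion of the host graph represents an `S₂`-expansion of the
encoded graph: besides those of the scheme, each copy has one symbol for the vertices of the encoded
graph in that copy, and one for each element of `S₂`. -/
abbrev Marks (I : Scheme) (S₂ : Type) : Type := I.S ⊕ I.ι ⊕ S₂ × I.ι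

/-- The expansion of the host graph that represents the expansion `Q` of the encoded graph. -/
def marks (I : Scheme) {S₂ : Type} {V W : Type u} (P : I.S → Set V) (Q : S₂ → Set W)
    (e : W → V × I.ι) : I.Marks S₂ → Set V :=
  Sum.elim P <| Sum.elim (fun i => {v | ∃ w, e w = (v, i)})
    fun c => {v | ∃ w ∈ Q c.1, e w = (v, c.2)}

/-- A formula on the encoded graph is equivalent to a formula on the host graph, once it is known in
which copy each free variable lies. -/
theorem exists_translation (I : Scheme) {S₂ : Type} {n : ℕ}
    (φ : (expandedLanguage S₂).Formula (Fin n)) (f : Fin n → I.ι) :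
    ∃ R : RelFamily.{u} (I.Marks S₂) n, IsDefinable R ∧
      ∀ {V W : Type u} {G : SimpleGraph V} {P : I.S → Set V} {K : SimpleGraph W}
        {e : W → V × I.ι} (Q : S₂ → Set W), I.Encodes G P K e →
        ∀ x : Fin n → W, (∀ i, (e (x i)).2 = f i) →
          (R V G (I.marks P Q e) (fun i => (e (x i)).1) ↔ Holds K Q φ x) := by
  revert f
  refine holds_induction (motive := fun n R₀ => ∀ f : Fin n → I.ι,
    ∃ R : RelFamily.{u} (I.Marks S₂) n, IsDefinable R ∧
      ∀ {V W : Type u} {G : SimpleGraph V} {P : I.S → Set V} {K : SimpleGraph W}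
        {e : W → V × I.ι} (Q : S₂ → Set W), I.Encodes G P K e →
        ∀ x : Fin n → W, (∀ i, (e (x i)).2 = f i) →
          (R V G (I.marks P Q e) (fun i => (e (x i)).1) ↔ R₀ W K Q x)) ?_ ?_ ?_ ?_ ?_ ?_ φ
  · exact fun n f => ⟨_, .false, fun _ _ _ _ => Iff.rfl⟩
  · intro n i j f
    refine ⟨_, (IsDefinable.const (f i = f j)).and (.eq i j), fun Q he x hx => ?_⟩
    rw [← hx, ← hx, and_comm, ← Prod.ext_iff, he.injective.eq_iff]
  · intro n i j f
    refine ⟨_, ((IsDefinable.holds (I.η (f i) (f j))).mapColor Sum.inl).comp ![i, j],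
      fun {V W G P K e} Q he x hx => ?_⟩
    refine Iff.trans ?_ (he.adj_iff (x i) (x j)).symm
    rw [hx, hx]
    apply iff_of_eq
    congr 1
    ext a
    fin_cases a <;> rfl
  · intro n c i f
    refine ⟨_, .color (Sum.inr (Sum.inr (c, f i))) i, fun {V W G P K e} Q he x hx => ?_⟩
    constructor
    · rintro ⟨w, hw, h⟩
      rwa [← he.injective (h.trans (Prod.ext rfl (hx i).symm))]
    · exact fun h => ⟨x i, h, Prod.ext rfl (hx i)⟩
  · intro n R₁ R₂ h₁ h₂ f
    obtain ⟨R₁', d₁, h₁⟩ := h₁ f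
    obtain ⟨R₂', d₂, h₂⟩ := h₂ f
    exact ⟨_, d₁.imp d₂, fun Q he x hx => imp_congr (h₁ Q he x hx) (h₂ Q he x hx)⟩
  · intro n R₀ h f
    choose R d h using fun i => h (Fin.snoc f i)
    refine ⟨_, IsDefinable.iAll fun i =>
      ((IsDefinable.color (Sum.inr (Sum.inl i)) (Fin.last n)).imp (d i)).all,
      fun {V W G P K e} Q he x hx => ?_⟩
    have key : ∀ w, (Fin.snoc (fun i => (e (x i)).1) (e w).1 : Fin (n + 1) → V) =
        fun i => (e ((Fin.snoc x w : Fin (n + 1) → W) i)).1 := by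
      intro w
      ext j
      refine Fin.lastCases ?_ (fun j => ?_) j <;> simp
    have hx' : ∀ w i, (e ((Fin.snoc x w : Fin (n + 1) → W) i)).2 =
        (Fin.snoc f (e w).2 : Fin (n + 1) → I.ι) i := by
      intro w j
      refine Fin.lastCases ?_ (fun j => ?_) j <;> simp [hx]
    constructor
    · intro H w
      have := H (e w).2 (e w).1
      rw [key] at this
      refine (h _ Q he _ (hx' w)).1 (this ?_)
      simp only [Fin.snoc_last]
      exact ⟨w, rfl⟩
    · rintro H i v hv
      simp only [Fin.snoc_last] at hv
      obtain ⟨w, hw⟩ := hv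
      obtain rfl : (e w).1 = v := by rw [hw]
      obtain rfl : (e w).2 = i := by rw [hw]
      rw [key]
      exact (h _ Q he _ (hx' w)).2 (H w)

/-- The scheme whose adjacency is given by definable relations. -/
noncomputable def ofRel {ι S : Type} [Finite ι] [Finite S] (R : ι → ι → RelFamily.{u} S 2)
    (hR : ∀ i j, IsDefinable (R i j)) : Scheme where
  ι := ι
  S := S
  finite_ι := inferInstance
  finite_S := inferInstance
  η i j := (hR i j).choose

theorem ofRel_produces {ι S : Type} [Finite ι] [Finite S] {R : ι → ι → RelFamily.{u} S 2}
    {hR : ∀ i j, IsDefinable (R i j)} {V W : Type u} {G : SimpleGraph V} {H : SimpleGraph W}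
    (P : S → Set V) (e : W → V × ι) (he : Function.Injective e)
    (h : ∀ x y, H.Adj x y ↔ R (e x).2 (e y).2 V G P ![(e x).1, (e y).1]) :
    (ofRel R hR).Produces G H :=
  ⟨P, e, he, fun x y => (h x y).trans ((hR _ _).choose_spec V G P _).symm⟩

/-- The scheme whose results are the induced subgraphs. -/
noncomputable def induced : Scheme :=
  ofRel.{u} (ι := Unit) (S := Empty) (fun _ _ _ G _ x => G.Adj (x 0) (x 1)) fun _ _ => .adj 0 1

theorem induced_encodes {V W : Type u} {G : SimpleGraph V} {H : SimpleGraph W} (f : H ↪g G) :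
    induced.{u}.Encodes G (fun c : Empty => c.elim) H fun w => (f w, ()) where
  injective _ _ h := f.injective (Prod.ext_iff.1 h).1
  adj_iff x y := (f.map_adj_iff (v := x) (w := y)).symm.trans
    ((IsDefinable.adj.{u} (S := Empty) 0 1).choose_spec V G _ ![f x, f y]).symm

/-- The composition of two schemes. -/
theorem exists_comp (I₁ I₂ : Scheme) : ∃ I : Scheme, ∀ {V U W : Type u} {G : SimpleGraph V}
    {K : SimpleGraph U} {H : SimpleGraph W}, I₁.Produces G K → I₂.Produces K H →
      I.Produces G H := by
  choose R d h using fun (i j : I₁.ι × I₂.ι) =>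
    exists_translation.{u} I₁ (I₂.η i.2 j.2) ![i.1, j.1]
  refine ⟨ofRel R d, ?_⟩
  rintro V U W G K H ⟨P, e, he⟩ ⟨Q, e', he'⟩
  refine ofRel_produces (I₁.marks P Q e) (fun w => ((e (e' w).1).1, (e (e' w).1).2, (e' w).2))
    (fun x y hxy => ?_) fun x y => ?_
  · simp only [Prod.mk.injEq] at hxy
    exact he'.injective (Prod.ext (he.injective (Prod.ext hxy.1 hxy.2.1)) hxy.2.2)
  · rw [he'.adj_iff]
    refine (Iff.trans ?_ (h ((e (e' x).1).2, (e' x).2) ((e (e' y).1).2, (e' y).2) Q he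
      ![(e' x).1, (e' y).1] ?_)).symm
    · apply iff_of_eq
      congr 1
      ext a
      fin_cases a <;> rfl
    · intro a
      fin_cases a <;> rfl

/-- The identity scheme, seen as an interpretation of `G` in the bottom layer of a copy graph. -/
theorem induced_encodes_copyGraph {V : Type u} (G : SimpleGraph V) (k : ℕ) :
    induced.{u}.Encodes (copyGraph (k + 1) G) (fun c : Empty => c.elim) G
      fun v => ((v, (0 : Fin (k + 1))), ()) :=
  induced_encodes (G.boxProdLeft ⊤ 0)

end Scheme

theorem Transduction.exists_scheme (T : Transduction.{u}) : ∃ I : Scheme,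
    ∀ {V W : Type u} {G : SimpleGraph V} {H : SimpleGraph W}, T.Produces G H → I.Produces G H := by
  induction T with
  | nonCopying T =>
    have := T.finite_S
    refine ⟨Scheme.ofRel (ι := Unit) (S := T.S) (fun _ _ _ G P x => Holds G P T.η x)
      fun _ _ => .holds _, ?_⟩
    rintro V W G H ⟨P, ⟨f⟩⟩
    refine Scheme.ofRel_produces P (fun w => ((f.symm w).1, ())) (fun x y h => ?_) fun x y => ?_
    · exact f.symm.injective (Subtype.ext (Prod.ext_iff.1 h).1)
    · exact f.symm.map_adj_iff.symm
  | copy k hk =>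
    refine ⟨Scheme.ofRel (ι := Fin k) (S := Empty)
      (fun i j _ G _ x => (G.Adj (x 0) (x 1) ∧ i = j) ∨ (i ≠ j ∧ x 0 = x 1))
      fun i j => ((IsDefinable.adj 0 1).and (.const _)).or
        ((IsDefinable.const _).and (.eq 0 1)), ?_⟩
    rintro V W G H ⟨f⟩
    refine Scheme.ofRel_produces (fun c => c.elim) f.symm f.symm.injective fun x y => ?_
    exact f.symm.map_adj_iff.symm
  | comp T₁ T₂ h₁ h₂ =>
    obtain ⟨I₁, h₁⟩ := h₁
    obtain ⟨I₂, h₂⟩ := h₂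
    obtain ⟨I, h⟩ := Scheme.exists_comp I₁ I₂
    refine ⟨I, ?_⟩
    rintro V W G H ⟨U, K, hK, hH⟩
    exact h (h₁ hK) (h₂ hH)

/-- The unary symbols with which a copy graph of `G` carries an expansion of `G` on one layer, and
marks the vertices used by the scheme `I` in the other layers. -/
abbrev Scheme.LayerMarks (I : Scheme) : Type := Scheme.induced.{u}.Marks I.S ⊕ I.ι

/-- The symbol for the layer that carries `G` itself. -/
abbrev Scheme.LayerMarks.base (I : Scheme) : Scheme.LayerMarks.{u} I :=
  Sum.inl (Sum.inr (Sum.inl ()))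

/-- A scheme is realized by copying the graph and then applying a non-copying transduction. One
layer of the copies hosts the graph itself, where the formulas of the scheme are evaluated; a copy
of a vertex in another layer is matched with that vertex since they are adjacent. -/
theorem Scheme.exists_transduction (I : Scheme) : ∃ T : Transduction.{u},
    ∀ {V W : Type u} {G : SimpleGraph V} {H : SimpleGraph W}, I.Produces G H → T.Produces G H := by
  obtain ⟨k, ⟨c⟩⟩ := Finite.exists_equiv_fin I.ι
  choose R d h using fun i j : I.ι =>
    Scheme.exists_translation.{u} Scheme.induced.{u} (I.η i j) fun _ => ()
  -- `θ` holds for two copies of vertices if the corresponding vertices of the base layer satisfy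
  -- the formula of the scheme for the two layers
  let θ : RelFamily.{u} (LayerMarks.{u} I) 2 := fun V G P x =>
    ∃ i j, (x 0 ∈ P (Sum.inr i) ∧ x 1 ∈ P (Sum.inr j)) ∧
      ∃ a b : V, (a ∈ P (LayerMarks.base I) ∧ b ∈ P (LayerMarks.base I)) ∧
        (G.Adj a (x 0) ∧ G.Adj b (x 1)) ∧ R i j V G (fun m => P (Sum.inl m)) ![a, b]
  have dθ : IsDefinable θ := by
    refine .iEx fun i => .iEx fun j => ((IsDefinable.color _ 0).and (.color _ 1)).and ?_
    have d' := ((d i j).mapColor (Sum.inl : _ → LayerMarks.{u} I)).comp (m := 4) ![2, 3]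
    refine ((((IsDefinable.color (LayerMarks.base I) 2).and (.color (LayerMarks.base I) 3)).and
      (((IsDefinable.adj 2 0).and (.adj 3 1)).and d')).ex.ex).congr fun V G P x => ?_
    refine exists_congr fun a => exists_congr fun b => ?_
    have : (fun i => (Fin.snoc (Fin.snoc x a : Fin 3 → V) b : Fin 4 → V)
        ((![2, 3] : Fin 2 → Fin 4) i)) = ![a, b] := by
      ext i
      fin_cases i <;> rfl
    rw [this]
    exact Iff.rfl
  have dν : IsDefinable.{u} (S := LayerMarks.{u} I) (n := 1) fun V G P x =>
      ∃ i, x 0 ∈ P (Sum.inr i) :=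
    .iEx fun i => .color _ 0
  -- the disjunction makes the relation symmetric on all expanded graphs
  have dη : IsDefinable.{u} (S := LayerMarks.{u} I) (n := 2) fun V G P x =>
      ¬ x 0 = x 1 ∧ (θ V G P ![x 0, x 1] ∨ θ V G P ![x 1, x 0]) := by
    refine ((IsDefinable.eq 0 1).not.and ((dθ.comp ![0, 1]).or (dθ.comp ![1, 0]))).congr
      fun V G P x => ?_
    have h₁ : (fun i => x ((![0, 1] : Fin 2 → Fin 2) i)) = ![x 0, x 1] := by
      ext i
      fin_cases i <;> rfl
    have h₂ : (fun i => x ((![1, 0] : Fin 2 → Fin 2) i)) = ![x 1, x 0] := by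
      ext i
      fin_cases i <;> rfl
    rw [h₁, h₂]
  obtain ⟨ν, hν⟩ := dν
  obtain ⟨η, hη⟩ := dη
  let T : NonCopyingTransduction.{u} :=
    { S := LayerMarks.{u} I
      finite_S := by infer_instance
      ν := ν
      η := η
      symmetric := fun G P x y => by
        rw [hη, hη]
        exact and_congr ⟨Ne.symm, Ne.symm⟩ or_comm
      antireflexive := fun G P x y hxy => ((hη _ _ _ _).1 hxy).1 }
  refine ⟨.comp (.copy (k + 1) k.succ_pos) (.nonCopying T), ?_⟩
  rintro V W G H ⟨P, e, he⟩
  let pos : W → V × Fin (k + 1) := fun w => ((e w).1, (c (e w).2).succ)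
  have pos_inj : Function.Injective pos := fun x y hxy => by
    simp only [pos, Prod.mk.injEq, Fin.succ_inj, c.apply_eq_iff_eq] at hxy
    exact he.injective (Prod.ext hxy.1 hxy.2)
  let Q : LayerMarks.{u} I → Set (V × Fin (k + 1)) := Sum.elim
    (Scheme.induced.{u}.marks (fun c : Empty => c.elim) P fun v => ((v, (0 : Fin (k + 1))), ()))
    fun i => {p | ∃ w, (e w).2 = i ∧ pos w = p}
  have hbase : ∀ p, p ∈ Q (LayerMarks.base I) ↔ ∃ v, (v, 0) = p := fun p =>
    ⟨fun ⟨v, hv⟩ => ⟨v, (Prod.ext_iff.1 hv).1⟩, fun ⟨v, hv⟩ => ⟨v, Prod.ext hv rfl⟩⟩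
  have hadj : ∀ v w, (copyGraph (k + 1) G).Adj (v, 0) (pos w) ↔ v = (e w).1 := fun v w => by
    simp [copyGraph, pos, SimpleGraph.boxProd_adj, (Fin.succ_ne_zero _).symm]
  have hθ : ∀ x y, θ _ (copyGraph (k + 1) G) Q ![pos x, pos y] ↔ H.Adj x y := by
    intro x y
    rw [he.adj_iff, ← h _ _ P (Scheme.induced_encodes_copyGraph G k) ![(e x).1, (e y).1]
      fun _ => rfl]
    have hv : ∀ v w : V, (fun i => (![v, w] i, (0 : Fin (k + 1)))) = ![(v, 0), (w, 0)] := by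
      intro v w
      ext i : 1
      fin_cases i <;> rfl
    simp only [hv]
    constructor
    · rintro ⟨i, j, ⟨⟨x', rfl, hx⟩, y', rfl, hy⟩, a, b, ⟨ha, hb⟩, ⟨hax, hby⟩, hR⟩
      obtain rfl : x' = x := pos_inj hx
      obtain rfl : y' = y := pos_inj hy
      obtain ⟨v, rfl⟩ := (hbase _).1 ha
      obtain ⟨w, rfl⟩ := (hbase _).1 hb
      obtain rfl := (hadj v x').1 hax
      obtain rfl := (hadj w y').1 hby
      exact hR
    · intro hR
      exact ⟨_, _, ⟨⟨x, rfl, rfl⟩, y, rfl, rfl⟩, _, _, ⟨(hbase _).2 ⟨_, rfl⟩, (hbase _).2 ⟨_, rfl⟩⟩,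
        ⟨(hadj _ x).2 rfl, (hadj _ y).2 rfl⟩, hR⟩
  have hmem : ∀ w, Holds (copyGraph (k + 1) G) Q ν ![pos w] := fun w =>
    (hν _ _ _ _).2 ⟨_, w, rfl, rfl⟩
  refine ⟨V × Fin (k + 1), copyGraph (k + 1) G, ⟨SimpleGraph.Iso.refl⟩, Q, ⟨RelIso.symm
    ⟨Equiv.ofBijective (fun w => ⟨pos w, hmem w⟩) ⟨fun x y hxy => ?_, ?_⟩, fun {x y} => ?_⟩⟩⟩
  · exact pos_inj (congrArg Subtype.val hxy)
  · rintro ⟨p, hp⟩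
    obtain ⟨i, w, -, hw⟩ := (hν _ _ _ _).1 hp
    exact ⟨w, Subtype.ext hw⟩
  · change Holds (copyGraph (k + 1) G) Q η ![pos x, pos y] ↔ H.Adj x y
    rw [hη]
    change ¬ pos x = pos y ∧ (θ _ (copyGraph (k + 1) G) Q ![pos x, pos y] ∨
      θ _ (copyGraph (k + 1) G) Q ![pos y, pos x]) ↔ H.Adj x y
    rw [hθ, hθ, pos_inj.eq_iff, H.adj_comm y x, or_self]
    exact ⟨And.right, fun hxy => ⟨hxy.ne, hxy⟩⟩

theorem isTransductionOf_iff {C D : GraphClass.{u}} : IsTransductionOf C D ↔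
    ∃ I : Scheme, ∀ (W : Type u) (H : SimpleGraph W), C W H →
      ∃ (V : Type u) (G : SimpleGraph V), D V G ∧ I.Produces G H := by
  constructor
  · rintro ⟨T, hT⟩
    obtain ⟨I, hI⟩ := T.exists_scheme
    refine ⟨I, fun W H hH => ?_⟩
    obtain ⟨V, G, hG, h⟩ := hT W H hH
    exact ⟨V, G, hG, hI h⟩
  · rintro ⟨I, hI⟩
    obtain ⟨T, hT⟩ := I.exists_transduction
    refine ⟨T, fun W H hH => ?_⟩
    obtain ⟨V, G, hG, h⟩ := hI W H hH
    exact ⟨V, G, hG, hT h⟩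

theorem IsTransductionOf.trans {C D E : GraphClass.{u}} (h₁ : IsTransductionOf C D)
    (h₂ : IsTransductionOf D E) : IsTransductionOf C E := by
  obtain ⟨T₁, h₁⟩ := h₁
  obtain ⟨T₂, h₂⟩ := h₂
  refine ⟨.comp T₂ T₁, fun W H hH => ?_⟩
  obtain ⟨U, K, hK, hKH⟩ := h₁ W H hH
  obtain ⟨V, G, hG, hGK⟩ := h₂ U K hK
  exact ⟨V, G, hG, U, K, hGK, hKH⟩

/-- Every class of balls is a transduction of the class that the balls are taken from. -/
theorem ballClass_isTransductionOf (r : ℕ) (C : GraphClass.{u}) :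
    IsTransductionOf (ballClass r C) C := by
  refine isTransductionOf_iff.2 ⟨Scheme.induced.{u}, ?_⟩
  rintro W H ⟨V, G, v, hG, ⟨f⟩⟩
  exact ⟨V, G, hG, _, _, Scheme.induced_encodes
    (f.toEmbedding.trans (SimpleGraph.Embedding.comap ⟨_, Subtype.val_injective⟩ G))⟩

/-! ### Locality of first-order formulas -/

/-- An increasing sequence of sets of vertices, in which no set is adjacent to the complement of the
next one. The map `f` identifies a type with the `m`-th set of the sequence. -/
structure IsLayering {U V : Type u} (G : SimpleGraph V) (B : ℕ → Set V) (m : ℕ) (f : U → V) :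
    Prop where
  mono : Monotone B
  not_adj : ∀ j v w, v ∈ B j → w ∉ B (j + 1) → ¬ G.Adj v w
  injective : Function.Injective f
  range_eq : Set.range f = B m

/-- The expansion of the graph that `G` induces on the `m`-th set of a layering: besides the symbols
of the expansion of `G`, it has a symbol for each of the layers. -/
def layerMarks {S : Type} {U V : Type u} (P : S → Set V) (B : ℕ → Set V) (m : ℕ) (f : U → V) :
    S ⊕ Fin (m + 1) → Set U :=
  Sum.elim (fun c => f ⁻¹' P c) fun j => f ⁻¹' B j

theorem IsDefinable.iff {S : Type} {n : ℕ} {R R' : RelFamily.{u} S n} (h : IsDefinable R)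
    (h' : IsDefinable R') : IsDefinable fun V G P x => R V G P x ↔ R' V G P x :=
  ((h.imp h').and (h'.imp h)).congr fun _ _ _ _ => iff_def.symm

/-- The assignment that maps the near variables through `f` and leaves the other ones. -/
def combine {n : ℕ} {U V : Type u} (near : Fin n → Bool) (f : U → V) (x : Fin n → U)
    (z : Fin n → V) (j : Fin n) : V :=
  if near j then f (x j) else z j

theorem snoc_combine_near {n : ℕ} {U V : Type u} (near : Fin n → Bool) (f : U → V) (x : Fin n → U)
    (z : Fin n → V) (w : U) (a : V) : (Fin.snoc (combine near f x z) (f w) : Fin (n + 1) → V) =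
      combine (Fin.snoc near true) f (Fin.snoc x w) (Fin.snoc z a) := by
  ext j
  refine Fin.lastCases ?_ (fun j => ?_) j <;> simp [combine]

theorem snoc_combine_far {n : ℕ} {U V : Type u} (near : Fin n → Bool) (f : U → V) (x : Fin n → U)
    (z : Fin n → V) (w : U) (a : V) : (Fin.snoc (combine near f x z) a : Fin (n + 1) → V) =
      combine (Fin.snoc near false) f (Fin.snoc x w) (Fin.snoc z a) := by
  ext j
  refine Fin.lastCases ?_ (fun j => ?_) j <;> simp [combine]

/-- For the tuples `x` and `x'` of vertices in an inner layer, and a tuple of vertices far outside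
of this layer, a formula cannot tell `x` from `x'` if finitely many formulas, evaluated in the
graph induced by an outer layer, cannot do so. The proof plays an Ehrenfeucht-Fraïssé game between
the graph and itself: a new vertex is either near, and then it is answered in the induced graph,
or far, and then it is its own answer. -/
theorem locality {S : Type} {n : ℕ} (φ : (expandedLanguage S).Formula (Fin n)) :
    ∃ g : ℕ, ∀ m i, i + g ≤ m → ∀ near : Fin n → Bool,
      ∃ (κ : Type) (_ : Finite κ) (δ : κ → RelFamily.{u} (S ⊕ Fin (m + 1)) n),
        (∀ d, IsDefinable (δ d)) ∧
        ∀ {U V : Type u} [Nonempty U] {G : SimpleGraph V} (P : S → Set V) {B : ℕ → Set V}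
          {f : U → V}, IsLayering G B m f →
        ∀ x x' : Fin n → U, (∀ j, near j → f (x j) ∈ B i) → (∀ j, near j → f (x' j) ∈ B i) →
        ∀ z : Fin n → V, (∀ j, near j = false → z j ∉ B (i + g)) →
          (∀ d, δ d U (G.comap f) (layerMarks P B m f) x ↔
            δ d U (G.comap f) (layerMarks P B m f) x') →
          (Holds G P φ (combine near f x z) ↔ Holds G P φ (combine near f x' z)) := by
  refine holds_induction (motive := fun n R => ∃ g : ℕ, ∀ m i, i + g ≤ m → ∀ near : Fin n → Bool,
      ∃ (κ : Type) (_ : Finite κ) (δ : κ → RelFamily.{u} (S ⊕ Fin (m + 1)) n),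
        (∀ d, IsDefinable (δ d)) ∧
        ∀ {U V : Type u} [Nonempty U] {G : SimpleGraph V} (P : S → Set V) {B : ℕ → Set V}
          {f : U → V}, IsLayering G B m f →
        ∀ x x' : Fin n → U, (∀ j, near j → f (x j) ∈ B i) → (∀ j, near j → f (x' j) ∈ B i) →
        ∀ z : Fin n → V, (∀ j, near j = false → z j ∉ B (i + g)) →
          (∀ d, δ d U (G.comap f) (layerMarks P B m f) x ↔
            δ d U (G.comap f) (layerMarks P B m f) x') →
          (R V G P (combine near f x z) ↔ R V G P (combine near f x' z))) ?_ ?_ ?_ ?_ ?_ ?_ φ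
  · exact fun n => ⟨0, fun m i _ near => ⟨Empty, inferInstance, nofun, nofun, by simp⟩⟩
  · refine fun n a b => ⟨0, fun m i _ near => ⟨Unit, inferInstance, fun _ _ _ _ x => x a = x b,
      fun _ => .eq a b, ?_⟩⟩
    intro U V _ G P B f hf x x' hx hx' z hz h
    have h := h ()
    simp only [add_zero] at hz
    dsimp only [combine]
    cases ha : near a <;> cases hb : near b
    · simp
    · exact iff_of_false (fun h => hz a ha (by simp_all)) fun h => hz a ha (by simp_all)
    · exact iff_of_false (fun h => hz b hb (by have := hx a ha; simp_all))
        fun h => hz b hb (by have := hx' a ha; simp_all)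
    · simpa [hf.injective.eq_iff] using h
  · refine fun n a b => ⟨1, fun m i _ near => ⟨Unit, inferInstance,
      fun _ _ G _ x => G.Adj (x a) (x b), fun _ => .adj a b, ?_⟩⟩
    intro U V _ G P B f hf x x' hx hx' z hz h
    have h := h ()
    dsimp only [combine]
    cases ha : near a <;> cases hb : near b
    · simp
    · exact iff_of_false (fun h => hf.not_adj i _ _ (hx b hb) (hz a ha) (by simpa using h.symm))
        fun h => hf.not_adj i _ _ (hx' b hb) (hz a ha) (by simpa using h.symm)
    · exact iff_of_false (fun h => hf.not_adj i _ _ (hx a ha) (hz b hb) (by simpa using h))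
        fun h => hf.not_adj i _ _ (hx' a ha) (hz b hb) (by simpa using h)
    · simpa using h
  · refine fun n c a => ⟨0, fun m i _ near => ⟨Unit, inferInstance,
      fun _ _ _ P x => x a ∈ P (Sum.inl c), fun _ => .color _ a, ?_⟩⟩
    intro U V _ G P B f hf x x' hx hx' z hz h
    have h := h ()
    dsimp only [combine]
    cases ha : near a
    · simp
    · simpa [layerMarks] using h
  · rintro n R₁ R₂ ⟨g₁, h₁⟩ ⟨g₂, h₂⟩
    refine ⟨g₁ + g₂, fun m i hi near => ?_⟩
    obtain ⟨κ₁, _, δ₁, d₁, h₁⟩ := h₁ m i (by lia) near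
    obtain ⟨κ₂, _, δ₂, d₂, h₂⟩ := h₂ m i (by lia) near
    refine ⟨κ₁ ⊕ κ₂, inferInstance, Sum.elim δ₁ δ₂, Sum.forall.2 ⟨d₁, d₂⟩, ?_⟩
    intro U V _ G P B f hf x x' hx hx' z hz h
    refine imp_congr (h₁ P hf x x' hx hx' z (fun j hj hz' => hz j hj (hf.mono (by lia) hz'))
      fun d => h (Sum.inl d)) (h₂ P hf x x' hx hx' z
      (fun j hj hz' => hz j hj (hf.mono (by lia) hz')) fun d => h (Sum.inr d))
  · rintro n R ⟨g, h⟩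
    refine ⟨g + g, fun m i hi near => ?_⟩
    -- the quantified vertex counts as near if it is in the layer `i + g`
    obtain ⟨κ₁, _, δ₁, d₁, h₁⟩ := h m (i + g) (by lia) (Fin.snoc near true)
    obtain ⟨κ₂, _, δ₂, d₂, h₂⟩ := h m i (by lia) (Fin.snoc near false)
    refine ⟨Set κ₁ ⊕ Set κ₂, inferInstance, Sum.elim
      (fun D U K Q x => ∃ w, w ∈ Q (Sum.inr ⟨i + g, by lia⟩) ∧
        ∀ d, δ₁ d U K Q (Fin.snoc x w) ↔ d ∈ D)
      (fun D U K Q x => ∃ w, ∀ d, δ₂ d U K Q (Fin.snoc x w) ↔ d ∈ D), Sum.forall.2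
      ⟨fun D => ?_, fun D => (IsDefinable.iAll fun d => (d₂ d).iff (.const (d ∈ D))).ex⟩, ?_⟩
    · exact (((IsDefinable.color (Sum.inr ⟨i + g, by lia⟩) (Fin.last n)).and
        (IsDefinable.iAll fun d => (d₁ d).iff (.const (d ∈ D)))).ex).congr fun _ _ _ _ => by
          simp only [Fin.snoc_last, Sum.elim_inl]
    intro U V _ G P B f hf
    suffices key : ∀ x x' : Fin n → U, (∀ j, near j → f (x j) ∈ B i) →
        (∀ j, near j → f (x' j) ∈ B i) → ∀ z : Fin n → V,
        (∀ j, near j = false → z j ∉ B (i + (g + g))) → _ →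
        (∀ a : V, R V G P (Fin.snoc (combine near f x z) a)) →
          ∀ a : V, R V G P (Fin.snoc (combine near f x' z) a) from
      fun x x' hx hx' z hz h =>
        ⟨key x x' hx hx' z hz h, key x' x hx' hx z hz fun d => (h d).symm⟩
    intro x x' hx hx' z hz h hR a
    have hsnoc : ∀ (y : Fin n → U) (b : Bool) (j : ℕ) (w : U), i ≤ j → (b → f w ∈ B j) →
        (∀ j, near j → f (y j) ∈ B i) → ∀ l, (Fin.snoc near b : Fin (n + 1) → Bool) l →
        f ((Fin.snoc y w : Fin (n + 1) → U) l) ∈ B j := by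
      intro y b j w hj hw hy l
      refine Fin.lastCases ?_ (fun l => ?_) l
      · simpa using hw
      · simpa using fun hl => hf.mono hj (hy l hl)
    by_cases ha : a ∈ B (i + g)
    · obtain ⟨w', rfl⟩ : a ∈ Set.range f := hf.range_eq ▸ hf.mono (by lia) ha
      obtain ⟨w, hw, hD⟩ := (h (Sum.inl {d | δ₁ d U (G.comap f) (layerMarks P B m f)
        (Fin.snoc x' w')})).2 ⟨w', ha, fun d => Iff.rfl⟩
      rw [snoc_combine_near _ _ _ _ _ (f w)]
      refine (h₁ P hf _ _ (hsnoc x true _ w (by lia) (fun _ => hw) hx)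
        (hsnoc x' true _ w' (by lia) (fun _ => ha) hx') _ ?_ fun d => hD d).1
        (snoc_combine_near near f x z w (f w) ▸ hR (f w))
      intro l
      refine Fin.lastCases ?_ (fun l => ?_) l
      · simp
      · simpa [add_assoc] using hz l
    -- the induced graph has no vertex for `a`, whose variable takes an arbitrary value there
    · obtain ⟨w'⟩ := ‹Nonempty U›
      obtain ⟨w, hD⟩ := (h (Sum.inr {d | δ₂ d U (G.comap f) (layerMarks P B m f)
        (Fin.snoc x' w')})).2 ⟨w', fun d => Iff.rfl⟩
      rw [snoc_combine_far _ _ _ _ w']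
      refine (h₂ P hf _ _ (hsnoc x false _ w le_rfl (by simp) hx)
        (hsnoc x' false _ w' le_rfl (by simp) hx') _ ?_ fun d => hD d).1
        (snoc_combine_far near f x z w a ▸ hR a)
      intro l
      refine Fin.lastCases ?_ (fun l => ?_) l
      · simpa using ha
      · simpa using fun hl hz' => hz l hl (hf.mono (by lia) hz')

/-! ### Distinguishing vertices and balls -/

/-- The sets of vertices at distance at most `r + j` from some vertex in `Z` form a layering. -/
theorem isLayering_edist {U V : Type u} (G : SimpleGraph V) (Z : Set V) (r m : ℕ) {f : U → V}
    (hf : Function.Injective f)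
    (hm : ∀ v, v ∈ Set.range f ↔ ∃ c ∈ Z, G.edist c v ≤ ((r + m : ℕ) : ℕ∞)) :
    IsLayering G (fun j => {v | ∃ c ∈ Z, G.edist c v ≤ ((r + j : ℕ) : ℕ∞)}) m f where
  mono := fun j k hjk v ⟨c, hc, hv⟩ => ⟨c, hc, hv.trans (by exact_mod_cast by lia)⟩
  not_adj := fun j v w ⟨c, hc, hv⟩ hw hvw => hw ⟨c, hc, by
    refine (G.edist_triangle (v := v)).trans ?_
    rw [SimpleGraph.edist_eq_one_iff_adj.2 hvw, ← add_assoc]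
    push_cast at hv ⊢
    gcongr⟩
  injective := hf
  range_eq := Set.ext hm

theorem exists_uniform_bound {ι : Type} [Finite ι] (g : ι → ι → ℕ) : ∃ N, ∀ i j, g i j ≤ N := by
  obtain ⟨N, hN⟩ := (Set.finite_range fun p : ι × ι => g p.1 p.2).bddAbove
  exact ⟨N, fun i j => hN ⟨(i, j), rfl⟩⟩

/-- Among many vertices of a graph that is encoded in `G`, two have the same neighbours among the
vertices that are far from all of them in `G`. -/
theorem Scheme.exists_distinguishes_near (I : Scheme) : ∃ g N : ℕ,
    ∀ {V W : Type u} {G : SimpleGraph V} {P : I.S → Set V} {H : SimpleGraph W} {e : W → V × I.ι},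
      I.Encodes G P H e → ∀ z : Fin N → W, ∃ a b, a < b ∧
        ∀ y, ¬ (H.Adj (z a) y ↔ H.Adj (z b) y) → ∃ c, G.edist (e (z c)).1 (e y).1 ≤ (g : ℕ∞) := by
  choose gap h using fun i j => locality.{u} (I.η i j)
  obtain ⟨g, hg⟩ := exists_uniform_bound gap
  choose κ hκ δ _ h using fun i j => h i j g 0 (by simpa using hg i j) ![true, false]
  -- two vertices with the same colour are not distinguished by far vertices; the far variable is
  -- irrelevant to the formulas in the near part, and takes a fixed value there
  let Color := I.ι × ∀ i j, Set (κ i j)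
  refine ⟨g, Nat.card Color + 1, ?_⟩
  intro V W G P H e he z
  let B : ℕ → Set V := fun j =>
    {v | ∃ c ∈ Set.range fun c => (e (z c)).1, G.edist c v ≤ ((0 + j : ℕ) : ℕ∞)}
  have hB : IsLayering G B g (Subtype.val : B g → V) :=
    isLayering_edist G _ 0 g Subtype.val_injective fun v => by simp [B]
  have hz : ∀ c j, (e (z c)).1 ∈ B j := fun c j => ⟨_, ⟨c, rfl⟩, by simp⟩
  let u : Fin (Nat.card Color + 1) → B g := fun c => ⟨(e (z c)).1, hz c g⟩
  have : Nonempty (B g) := ⟨u 0⟩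
  let color : Fin (Nat.card Color + 1) → Color := fun c => ((e (z c)).2, fun i j =>
    {d | δ i j d (B g) (G.comap Subtype.val) (layerMarks P B g Subtype.val) ![u c, u 0]})
  obtain ⟨a, b, hab, hcolor⟩ : ∃ a b, a ≠ b ∧ color a = color b := by
    by_contra! hne
    have := Nat.card_le_card_of_injective color fun a b hab => by_contra fun h => hne a b h hab
    simp at this
  have hsame : ∀ y, (∀ c, ¬ G.edist (e (z c)).1 (e y).1 ≤ (g : ℕ∞)) →
      (H.Adj (z a) y ↔ H.Adj (z b) y) := by
    intro y hy
    have hι : (e (z a)).2 = (e (z b)).2 := (Prod.ext_iff.1 hcolor).1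
    rw [he.adj_iff, he.adj_iff, ← hι]
    have hcomb : ∀ c, combine ![true, false] Subtype.val ![u c, u 0] ![(e y).1, (e y).1] =
        ![(e (z c)).1, (e y).1] := by
      intro c
      ext j
      fin_cases j <;> rfl
    rw [← hcomb, ← hcomb]
    refine h _ _ P hB _ _ ?_ ?_ _ ?_ fun d => ?_
    · simpa [Fin.forall_fin_two] using hz a 0
    · simpa [Fin.forall_fin_two] using hz b 0
    · simp only [Fin.forall_fin_two]
      refine ⟨by simp, fun _ => ?_⟩
      rintro ⟨_, ⟨c, rfl⟩, hc⟩
      refine hy c (hc.trans ?_)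
      simpa using hg _ _
    · exact iff_of_eq (congrFun (congrFun (congrFun (Prod.ext_iff.1 hcolor).2 _) _) d)
  rcases lt_or_gt_of_ne hab with hab | hab
  · refine ⟨a, b, hab, fun y hy => ?_⟩
    by_contra! hfar
    exact hy (hsame y fun c => (hfar c).not_ge)
  · refine ⟨b, a, hab, fun y hy => ?_⟩
    by_contra! hfar
    exact hy (hsame y fun c => (hfar c).not_ge).symm

/-- The part of the encoded graph that is hosted by a ball of `G` can be encoded in a larger ball.
On the small ball, the formulas of the scheme `I` are Boolean combinations of formulas that are
evaluated in the large ball. Which ones depends on `G` and the centre of the ball, but there are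
finitely many possibilities; unary symbols that hold everywhere or nowhere tell the right one. -/
theorem Scheme.exists_closedBall_produces (I : Scheme) (r : ℕ) : ∃ (R : ℕ) (J : Scheme),
    ∀ {V W W' : Type u} {G : SimpleGraph V} {P : I.S → Set V} {H : SimpleGraph W}
      {H' : SimpleGraph W'} {e : W → V × I.ι}, I.Encodes G P H e →
      ∀ (v : V) (f : H' ↪g H), (∀ x, G.edist v (e (f x)).1 ≤ (r : ℕ∞)) →
        J.Produces (closedBall G R v) H' := by
  choose gap h using fun i j => locality.{u} (I.η i j)
  obtain ⟨g, hg⟩ := exists_uniform_bound gap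
  choose κ hκ δ dδ h using fun i j => h i j g 0 (by simpa using hg i j) fun _ => true
  have dη : ∀ i j, IsDefinable.{u} (n := 2)
      (S := (I.S ⊕ Fin (g + 1)) ⊕ Σ p : I.ι × I.ι, Set (κ p.1 p.2)) fun V G P x =>
        ∃ t : Set (κ i j), x 0 ∈ P (Sum.inr ⟨(i, j), t⟩) ∧
          ∀ d, δ i j d V G (fun c => P (Sum.inl c)) x ↔ d ∈ t := fun i j =>
    .iEx fun t => (IsDefinable.color _ 0).and <|
      .iAll fun d => ((dδ i j d).mapColor Sum.inl).iff (.const _)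
  refine ⟨r + g, Scheme.ofRel _ dη, ?_⟩
  intro V W W' G P H H' e he v f hf
  let U := {w : V // G.edist v w ≤ ((r + g : ℕ) : ℕ∞)}
  let B : ℕ → Set V := fun j => {w | ∃ c ∈ ({v} : Set V), G.edist c w ≤ ((r + j : ℕ) : ℕ∞)}
  have hB : IsLayering G B g (Subtype.val : U → V) :=
    isLayering_edist G _ r g Subtype.val_injective fun v => by simp
  let Q := layerMarks P B g (Subtype.val : U → V)
  let e' : W' → U × I.ι := fun x => (⟨(e (f x)).1, (hf x).trans (by simp)⟩, (e (f x)).2)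
  have he'B : ∀ x, ((e' x).1 : V) ∈ B 0 := fun x => ⟨v, rfl, hf x⟩
  have : Nonempty U := ⟨⟨v, by simp⟩⟩
  refine Scheme.ofRel_produces (Sum.elim Q fun q => {_w | ∃ x : Fin 2 → U, (∀ l, (x l : V) ∈ B 0) ∧
    (∀ d, δ q.1.1 q.1.2 d U (closedBall G (r + g) v) Q x ↔ d ∈ q.2) ∧
    Holds G P (I.η q.1.1 q.1.2) fun l => (x l : V)}) e' (fun x y hxy => ?_) fun x y => ?_
  · refine f.injective (he.injective (Prod.ext ?_ ?_))
    · exact congrArg (fun p => (p.1 : V)) hxy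
    · exact congrArg (fun p => p.2) hxy
  · rw [← f.map_adj_iff, he.adj_iff]
    have hval : ![(e (f x)).1, (e (f y)).1] = fun l => ((![(e' x).1, (e' y).1] l : U) : V) := by
      ext l
      fin_cases l <;> rfl
    have hmem : ∀ l, ((![(e' x).1, (e' y).1] l : U) : V) ∈ B 0 := by
      simpa [Fin.forall_fin_two] using ⟨he'B x, he'B y⟩
    rw [hval]
    constructor
    · intro hxy
      exact ⟨{d | δ _ _ d U (closedBall G (r + g) v) Q ![(e' x).1, (e' y).1]},
        ⟨_, hmem, fun d => Iff.rfl, hxy⟩, fun d => Iff.rfl⟩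
    · rintro ⟨t, ⟨x', hx', ht', hη⟩, ht⟩
      exact (h _ _ P hB x' _ (fun l _ => hx' l) (fun l _ => hmem l) (fun l => x' l)
        (fun _ h => by simp at h) fun d => (ht' d).trans (ht d).symm).1 hη

/-! ### Reduction to a Ramsey property -/

/-- The distance `d` on the vertices of `H` is such that, among any `N` vertices, there are two that
are only distinguished by vertices at distance at most `g` from one of the `N` vertices. -/
structure IsConcentrated {W : Type u} (H : SimpleGraph W) (d : W → W → ℕ∞) (g N : ℕ) : Prop where
  triangle : ∀ x y z, d x z ≤ d x y + d y z
  exists_near : ∀ z : Fin N → W, ∃ a b, a < b ∧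
    ∀ y, ¬ (H.Adj (z a) y ↔ H.Adj (z b) y) → ∃ c, d (z c) y ≤ (g : ℕ∞)

namespace IsConcentrated

variable {W : Type u} {H : SimpleGraph W} {d : W → W → ℕ∞} {g N : ℕ}

theorem dist_le (h : IsConcentrated H d g N) {x y z : W} (hxy : d x y ≤ (g : ℕ∞))
    (hyz : d y z ≤ (g : ℕ∞)) : d x z ≤ ((2 * g : ℕ) : ℕ∞) := by
  refine (h.triangle x y z).trans ?_
  rw [two_mul]
  push_cast
  gcongr

end IsConcentrated

/-- Suppose that each graph in `Y` embeds in a graph of `X`, inside of a ball of bounded radius for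
every concentrated distance. Then `Y` is a transduction of a class of balls of `C` if `X` is a
transduction of `C`. -/
theorem IsTransductionOf.ballClass {X Y C : GraphClass.{u}} (hX : IsTransductionOf X C)
    (hXY : ∀ g N : ℕ, ∀ (W' : Type u) (H' : SimpleGraph W'), Y W' H' →
      ∃ (W : Type u) (H : SimpleGraph W), X W H ∧ ∀ d, IsConcentrated H d g N →
        ∃ (f : H' ↪g H) (w : W), ∀ x, d w (f x) ≤ ((2 * g : ℕ) : ℕ∞)) :
    ∃ r, IsTransductionOf Y (ballClass r C) := by
  obtain ⟨I, hI⟩ := isTransductionOf_iff.1 hX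
  obtain ⟨g, N, hgN⟩ := I.exists_distinguishes_near
  obtain ⟨R, J, hJ⟩ := I.exists_closedBall_produces (2 * g)
  refine ⟨R, isTransductionOf_iff.2 ⟨J, fun W' H' hH' => ?_⟩⟩
  obtain ⟨W, H, hH, hd⟩ := hXY g N W' H' hH'
  obtain ⟨V, G, hG, P, e, he⟩ := hI W H hH
  obtain ⟨f, w, hw⟩ := hd (fun x y => G.edist (e x).1 (e y).1)
    ⟨fun _ _ _ => G.edist_triangle, hgN he⟩
  exact ⟨_, closedBall G R (e w).1, ⟨V, G, (e w).1, hG, ⟨SimpleGraph.Iso.refl⟩⟩,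
    hJ he (e w).1 f hw⟩

/-! ### Half-graphs -/

@[simp] theorem halfGraph_adj_inl_inr {n : ℕ} (i j : Fin n) :
    (halfGraph n).Adj (Sum.inl i) (Sum.inr j) ↔ i ≤ j := by
  simp [halfGraph]

@[simp] theorem halfGraph_adj_inr_inl {n : ℕ} (i j : Fin n) :
    (halfGraph n).Adj (Sum.inr j) (Sum.inl i) ↔ i ≤ j := by
  simp [halfGraph]

@[simp] theorem halfGraph_adj_inl_inl {n : ℕ} (i j : Fin n) :
    ¬ (halfGraph n).Adj (Sum.inl i) (Sum.inl j) := by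
  simp [halfGraph]

@[simp] theorem halfGraph_adj_inr_inr {n : ℕ} (i j : Fin n) :
    ¬ (halfGraph n).Adj (Sum.inr i) (Sum.inr j) := by
  simp [halfGraph]

/-- A selection of the same indices on both sides of a half-graph is a half-graph. -/
def halfGraphEmbedding {n m : ℕ} (p : Fin n ↪o Fin m) : halfGraph n ↪g halfGraph m where
  toFun := Sum.map p p
  inj' := Sum.map_injective.2 ⟨p.injective, p.injective⟩
  map_rel_iff' := by
    rintro (i | i) (j | j) <;> simp

theorem exists_monochromatic_orderEmbedding {N K L : ℕ} (hN : 0 < N) (hL : L = N * K)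
    (c : Fin L → Fin N) : ∃ (k : Fin N) (q : Fin K ↪o Fin L), ∀ s, c (q s) = k := by
  obtain ⟨k, -, hk⟩ := Finset.exists_le_card_fiber_of_mul_le_card_of_maps_to (s := Finset.univ)
    (t := Finset.univ) (f := c) (n := K) (by simp) ⟨⟨0, hN⟩, Finset.mem_univ _⟩ (by simp [hL])
  exact ⟨k, Finset.orderEmbOfCardLe _ hk,
    fun s => (Finset.mem_filter.1 (Finset.orderEmbOfCardLe_mem _ hk s)).2⟩

/-- A long half-graph contains a given half-graph in a ball, for each concentrated distance. Equally
spaced vertices of the first sequence are distinguished by all vertices of the second sequence in an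
interval, and so many of these are in one ball. Equally spaced vertices among the latter are
distinguished by all vertices of the first sequence in an interval. -/
theorem exists_halfGraph_near {g N n L : ℕ} (hL : L = N * (N * (n + 1)))
    {d : Fin (N * L) ⊕ Fin (N * L) → Fin (N * L) ⊕ Fin (N * L) → ℕ∞}
    (hd : IsConcentrated (halfGraph (N * L)) d g N) :
    ∃ (f : halfGraph n ↪g halfGraph (N * L)) (w : _), ∀ x, d w (f x) ≤ ((2 * g : ℕ) : ℕ∞) := by
  have lt_mul : ∀ {a k t : ℕ}, a < N → t < k → a * k + t < N * k := fun {a k t} ha ht =>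
    calc a * k + t < (a + 1) * k := by rw [add_mul, one_mul]; lia
      _ ≤ N * k := Nat.mul_le_mul_right _ ha
  have add_le_mul : ∀ {a b k t : ℕ}, a < b → t ≤ k → a * k + t ≤ b * k := fun {a b k t} hab ht =>
    calc a * k + t ≤ (a + 1) * k := by rw [add_mul, one_mul]; lia
      _ ≤ b * k := Nat.mul_le_mul_right _ hab
  have L_pos : Fin N → 0 < L := fun c => by
    have := c.pos
    subst hL
    positivity
  obtain ⟨a, b, hab, h⟩ := hd.exists_near fun c => Sum.inl ⟨c * L + 0, lt_mul c.2 (L_pos c)⟩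
  let pos : Fin L ↪o Fin (N * L) := OrderEmbedding.ofStrictMono
    (fun t => ⟨a * L + t, lt_mul a.2 t.2⟩) fun s t hst => by simpa using hst
  have hpos : ∀ t, (pos t : ℕ) = a * L + t := fun _ => rfl
  choose c hc using fun t : Fin L => h (Sum.inr (pos t)) <| by
    have h₂ : a * L + t < b * L := (Nat.add_lt_add_left t.2 _).trans_le (add_le_mul hab le_rfl)
    simpa [Fin.le_def, hpos] using h₂
  obtain ⟨k, q, hq⟩ := exists_monochromatic_orderEmbedding a.pos hL c
  obtain ⟨a', b', hab', h'⟩ := hd.exists_near fun c => Sum.inr (pos (q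
    ⟨c * (n + 1) + 0, lt_mul c.2 n.succ_pos⟩))
  let p : Fin n ↪o Fin (N * (n + 1)) := OrderEmbedding.ofStrictMono
    (fun s => ⟨a' * (n + 1) + (s + 1), lt_mul a'.2 (by lia)⟩) fun s t hst => by simpa using hst
  have hp : ∀ s, (p s : ℕ) = a' * (n + 1) + (s + 1) := fun _ => rfl
  have near : ∀ s, d (Sum.inl ⟨k * L + 0, lt_mul k.2 (L_pos k)⟩) (Sum.inr (pos (q s))) ≤
      (g : ℕ∞) := fun s => hq s ▸ hc (q s)
  refine ⟨halfGraphEmbedding ((p.trans q).trans pos),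
    Sum.inl ⟨k * L + 0, lt_mul k.2 (L_pos k)⟩, ?_⟩
  rintro (s | s)
  · obtain ⟨c', hc'⟩ := h' (Sum.inl (pos (q (p s)))) <| by
      have h₂ : a' * (n + 1) + (s + 1) ≤ b' * (n + 1) := add_le_mul hab' (by lia)
      simpa [Fin.le_def, hp] using h₂
    exact hd.dist_le (near _) hc'
  · exact (near _).trans (by exact_mod_cast by lia)

theorem IsConcentrated.iso {W : Type*} {W' : Type*} {H : SimpleGraph W} {H' : SimpleGraph W'}
    {d : W → W → ℕ∞} {g N : ℕ} (hd : IsConcentrated H d g N) (f : H ≃g H') :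
    IsConcentrated H' (fun x y => d (f.symm x) (f.symm y)) g N where
  triangle _ _ _ := hd.triangle _ _ _
  exists_near z := by
    obtain ⟨a, b, hab, h⟩ := hd.exists_near fun c => f.symm (z c)
    refine ⟨a, b, hab, fun y hy => h (f.symm y) ?_⟩
    rwa [f.symm.map_adj_iff, f.symm.map_adj_iff]

theorem halfGraphs_isTransductionOf_ballClass {C : GraphClass.{u}}
    (h : IsTransductionOf halfGraphs C) : ∃ r, IsTransductionOf halfGraphs (ballClass r C) := by
  refine h.ballClass ?_
  rintro g N W' H' ⟨n, ⟨f'⟩⟩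
  let e : (halfGraph (N * (N * (N * (n + 1))))).comap ULift.down.{u} ≃g _ :=
    SimpleGraph.Iso.comap Equiv.ulift _
  refine ⟨_, _, ⟨_, ⟨e⟩⟩, fun d hd => ?_⟩
  obtain ⟨f, w, hw⟩ := exists_halfGraph_near rfl (hd.iso e)
  exact ⟨(f'.toEmbedding.trans f).trans e.symm.toEmbedding, e.symm w, fun x => hw (f' x)⟩

/-! ### Powerset graphs -/

/-- The bipartite graph between the elements and the subsets of `X`, with membership as adjacency.
-/
def powersetGraph (X : Type u) : SimpleGraph (X ⊕ Set X) :=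
  SimpleGraph.fromRel fun s t => ∃ x A, s = Sum.inl x ∧ t = Sum.inr A ∧ x ∈ A

@[simp] theorem powersetGraph_adj_inl_inr {X : Type u} (x : X) (A : Set X) :
    (powersetGraph X).Adj (Sum.inl x) (Sum.inr A) ↔ x ∈ A := by
  simp [powersetGraph]

@[simp] theorem powersetGraph_adj_inr_inl {X : Type u} (x : X) (A : Set X) :
    (powersetGraph X).Adj (Sum.inr A) (Sum.inl x) ↔ x ∈ A := by
  simp [powersetGraph]

@[simp] theorem powersetGraph_adj_inl_inl {X : Type u} (x y : X) :
    ¬ (powersetGraph X).Adj (Sum.inl x) (Sum.inl y) := by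
  simp [powersetGraph]

@[simp] theorem powersetGraph_adj_inr_inr {X : Type u} (A B : Set X) :
    ¬ (powersetGraph X).Adj (Sum.inr A) (Sum.inr B) := by
  simp [powersetGraph]

/-- The class of powerset graphs of finite sets. -/
def powersetGraphs : GraphClass.{u} := fun _ G =>
  ∃ X : Type u, Finite X ∧ Nonempty (G ≃g powersetGraph X)

/-- A finite graph is obtained from the powerset graph of its vertex set: two vertices are adjacent
if they have a common neighbour among the marked sets, which are the edges. -/
theorem finiteGraphs_isTransductionOf_powersetGraphs :
    IsTransductionOf finiteGraphs.{u} powersetGraphs := by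
  have dη : IsDefinable.{u} (S := Unit) (n := 2) fun _ G P x => ¬ x 0 = x 1 ∧
      ∃ s, s ∈ P () ∧ G.Adj s (x 0) ∧ G.Adj s (x 1) :=
    (IsDefinable.eq 0 1).not.and ((IsDefinable.color () 2).and
      ((IsDefinable.adj 2 0).and (.adj 2 1))).ex
  refine isTransductionOf_iff.2 ⟨Scheme.ofRel (ι := Unit) _ fun _ _ => dη, fun W H hW => ?_⟩
  refine ⟨_, powersetGraph W, ⟨W, hW, ⟨SimpleGraph.Iso.refl⟩⟩, ?_⟩
  refine Scheme.ofRel_produces (fun _ => {s | ∃ x y, H.Adj x y ∧ s = Sum.inr {x, y}})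
    (fun x => (Sum.inl x, ())) (fun x y h => by simpa using h) fun x y => ?_
  simp only [Matrix.cons_val_zero, Matrix.cons_val_one, Set.mem_ofPred_eq, Sum.inl.injEq]
  constructor
  · exact fun h => ⟨h.ne, _, ⟨x, y, h, rfl⟩, by simp⟩
  · rintro ⟨hxy, _, ⟨a, b, h, rfl⟩, hx, hy⟩
    simp only [powersetGraph_adj_inr_inl, Set.mem_insert_iff, Set.mem_singleton_iff] at hx hy
    rcases hx with rfl | rfl <;> rcases hy with rfl | rfl
    · exact absurd rfl hxy
    · exact h
    · exact h.symm
    · exact absurd rfl hxy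

/-- For each colouring of the subsets of `κ × Q` with colours in `κ`, the sets of some colour `k`
shatter the slice `{k} × Q`. Otherwise, for each `k`, some subset of this slice is not the trace of
a set of colour `k`; the union of these subsets has no colour. -/
theorem exists_color_shatters {κ Q : Type*} (c : Set (κ × Q) → κ) :
    ∃ k, ∀ A : Set Q, ∃ S, c S = k ∧ ∀ q, (k, q) ∈ S ↔ q ∈ A := by
  by_contra! h
  choose A hA using h
  obtain ⟨q, hq⟩ := hA (c {p | p.2 ∈ A p.1}) _ rfl
  simp at hq

/-- A large powerset graph contains the powerset graph of `X` in a ball, for each concentrated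
distance. In the ground set, the first `N` elements are distinguished by enough sets to shatter,
with sets near one of these elements, one of `N` copies of `Fin N × X`. In this copy, the `N`
slices are distinguished by their elements, and so the elements of one slice are in the ball too.
-/
theorem exists_powersetGraph_near {g N : ℕ} (X : Type u)
    {d : _ → _ → ℕ∞} (hd : IsConcentrated (powersetGraph (Fin N ⊕ Fin N × Fin N × X)) d g N) :
    ∃ (f : powersetGraph X ↪g powersetGraph (Fin N ⊕ Fin N × Fin N × X)) (w : _),
      ∀ x, d w (f x) ≤ ((2 * g : ℕ) : ℕ∞) := by
  -- all sets that distinguish two of the first `N` elements are near one of these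
  obtain ⟨a, b, hab, h⟩ := hd.exists_near fun c => Sum.inl (Sum.inl c)
  let extend : Set (Fin N × Fin N × X) → Set (Fin N ⊕ Fin N × Fin N × X) := fun S =>
    {p | Sum.elim (· = a) (· ∈ S) p}
  choose c hc using fun S => h (Sum.inr (extend S)) <| by
    simpa [extend] using hab.ne'
  obtain ⟨k, hk⟩ := exists_color_shatters c
  choose S hSk hS using hk
  have near : ∀ A, d (Sum.inl (Sum.inl k)) (Sum.inr (extend (S A))) ≤ (g : ℕ∞) :=
    fun A => hSk A ▸ hc (S A)
  -- all elements that distinguish two of the sets with a given trace are near one of these sets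
  obtain ⟨a', b', hab', h'⟩ := hd.exists_near fun c => Sum.inr (extend (S {q | q.1 = c}))
  have mem : ∀ A q, Sum.inr (k, q) ∈ extend (S A) ↔ q ∈ A := fun A q => by
    simp [extend, hS]
  let F : X ⊕ Set X → (Fin N ⊕ Fin N × Fin N × X) ⊕ Set (Fin N ⊕ Fin N × Fin N × X) :=
    Sum.map (fun x => Sum.inr (k, a', x)) fun A => extend (S {q | q.1 = a' ∧ q.2 ∈ A})
  have hF : Function.Injective F := by
    refine Sum.map_injective.2 ⟨fun x y h => by simpa using h, fun A B h => ?_⟩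
    ext x
    simpa [mem] using iff_of_eq (congrArg (fun T => Sum.inr (k, a', x) ∈ T) h)
  refine ⟨⟨⟨F, hF⟩, ?_⟩, Sum.inl (Sum.inl k), ?_⟩
  · rintro (x | A) (y | B) <;> simp [F, mem]
  · rintro (x | A)
    · obtain ⟨c', hc'⟩ := h' (Sum.inl (Sum.inr (k, a', x))) <| by
        simpa [mem] using hab'.ne
      exact hd.dist_le (near _) hc'
    · exact (near _).trans (by exact_mod_cast by lia)

theorem finiteGraphs_isTransductionOf_ballClass {C : GraphClass.{u}}
    (h : IsTransductionOf finiteGraphs C) : ∃ r, IsTransductionOf finiteGraphs (ballClass r C) := by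
  have hXY : ∃ r, IsTransductionOf powersetGraphs (ballClass r C) := by
    refine h.ballClass ?_
    rintro g N W' H' ⟨X, hX, ⟨f'⟩⟩
    refine ⟨_, powersetGraph (Fin N ⊕ Fin N × Fin N × X), ?_, fun d hd => ?_⟩
    · change Finite _
      infer_instance
    · obtain ⟨f, w, hw⟩ := exists_powersetGraph_near X hd
      exact ⟨f'.toEmbedding.trans f, w, fun x => hw (f' x)⟩
  obtain ⟨r, hr⟩ := hXY
  exact ⟨r, finiteGraphs_isTransductionOf_powersetGraphs.trans hr⟩

/-! ### Trees of words -/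

/-- The longest common prefix of two words. -/
def commonPrefix {A : Type u} [DecidableEq A] : List A → List A → List A
  | a :: l, b :: m => if a = b then a :: commonPrefix l m else []
  | _, _ => []

theorem prefix_commonPrefix_iff {A : Type u} [DecidableEq A] (k l m : List A) :
    k <+: commonPrefix l m ↔ k <+: l ∧ k <+: m := by
  induction l generalizing k m with
  | nil => cases m <;> simp +contextual [commonPrefix]
  | cons a l ih =>
    cases m with
    | nil => simp +contextual [commonPrefix]
    | cons b m =>
      cases k with
      | nil => simp
      | cons c k =>
        by_cases hab : a = b
        · simp only [commonPrefix, hab, if_true, List.cons_prefix_cons, ih]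
          tauto
        · simp only [commonPrefix, hab, if_false, List.cons_prefix_cons, List.prefix_nil,
            reduceCtorEq, false_iff, not_and, and_imp]
          rintro rfl _ rfl
          exact absurd rfl hab

/-- The words of length at most `D` over the alphabet `A`, ordered by the prefix relation. -/
@[ext]
structure Words (A : Type u) (D : ℕ) : Type u where
  /-- The word, as a list of letters. -/
  val : List A
  length_le : val.length ≤ D

namespace Words

variable {A : Type u} {D : ℕ}

instance : PartialOrder (Words A D) where
  le l m := l.1 <+: m.1
  le_refl l := List.prefix_rfl
  le_trans _ _ _ := List.IsPrefix.trans
  le_antisymm l m h h' := Words.ext (h.eq_of_length_le h'.length_le)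

theorem le_iff {l m : Words A D} : l ≤ m ↔ l.1 <+: m.1 := Iff.rfl

noncomputable instance : SemilatticeInf (Words A D) := by
  classical exact
  { inf := fun l m => ⟨commonPrefix l.1 m.1,
      (((prefix_commonPrefix_iff _ l.1 m.1).1 List.prefix_rfl).1.length_le).trans l.2⟩
    inf_le_left := fun l m => ((prefix_commonPrefix_iff _ l.1 m.1).1 List.prefix_rfl).1
    inf_le_right := fun l m => ((prefix_commonPrefix_iff _ l.1 m.1).1 List.prefix_rfl).2
    le_inf := fun k l m h h' => (prefix_commonPrefix_iff k.1 l.1 m.1).2 ⟨h, h'⟩ }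

instance : OrderBot (Words A D) where
  bot := ⟨[], Nat.zero_le _⟩
  bot_le _ := List.nil_prefix

theorem prefix_dropLast_of_ne {l m : List A} (h : l <+: m) (hne : l ≠ m) : l <+: m.dropLast := by
  obtain ⟨t, rfl⟩ := h
  have ht : t ≠ [] := by
    rintro rfl
    simp at hne
  rw [List.dropLast_append_of_ne_nil ht]
  exact List.prefix_append _ _

instance : PredOrder (Words A D) where
  pred l := ⟨l.1.dropLast, by simpa using l.2.trans (Nat.le_succ D)⟩
  pred_le l := List.dropLast_prefix l.1
  min_of_le_pred {l} h := by
    have hl := List.IsPrefix.length_le h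
    rw [List.length_dropLast] at hl
    have : l.1 = [] := List.length_eq_zero_iff.1 (by lia)
    intro m _
    exact le_iff.2 (this ▸ List.nil_prefix)
  le_pred_of_lt {l m} h := prefix_dropLast_of_ne h.le fun h' => h.ne (Words.ext h')

theorem pred_val (l : Words A D) : (Order.pred l).1 = l.1.dropLast := rfl

instance : IsPredArchimedean (Words A D) where
  exists_pred_iterate_of_le {l m} h := by
    induction hn : m.1.length - l.1.length generalizing m with
    | zero => exact ⟨0, Words.ext (h.eq_of_length_le (by lia)).symm⟩
    | succ n ih =>
      have hlm : l ≠ m := by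
        rintro rfl
        simp at hn
      obtain ⟨k, hk⟩ := ih (Order.le_pred_of_lt (h.lt_of_ne hlm))
        (by rw [pred_val, List.length_dropLast]; lia)
      exact ⟨k + 1, hk⟩

instance [Finite A] : Finite (Words A D) :=
  have := (List.finite_length_le A D).to_subtype
  .of_injective (fun l : Words A D => (⟨l.1, l.2⟩ : {l : List A | l.length ≤ D}))
    fun _ _ h => Words.ext (congrArg Subtype.val h)

/-- The complete tree of words of length at most `D`. -/
noncomputable def tree (A : Type u) (D : ℕ) : RootedTree.{u} := ⟨Words A D⟩

end Words

/-- The comparability graph of a partial order. -/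
abbrev comparabilityGraph (α : Type u) [PartialOrder α] : SimpleGraph α :=
  SimpleGraph.fromRel fun x y => x ≤ y

/-- The nodes of a finite rooted tree are encoded by words, namely the paths that lead to them. -/
theorem exists_code (t : RootedTree.{u}) [Finite t] :
    ∃ code : t → List (Option t), ∀ x y, code x <+: code y ↔ x ≤ y := by
  classical
  have wf : WellFounded ((· < ·) : t → t → Prop) := wellFounded_lt
  let code : t → List (Option t) := wf.fix fun x ih =>
    if h : x = ⊥ then [] else ih (Order.pred x) (Order.pred_lt_of_not_isMin (by simpa using h)) ++
      [some x]
  have code_bot : code ⊥ = [] := by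
    change wf.fix _ _ = _
    rw [wf.fix_eq, dif_pos rfl]
  have code_eq : ∀ x, x ≠ ⊥ → code x = code (Order.pred x) ++ [some x] := by
    intro x hx
    change wf.fix _ _ = _
    rw [wf.fix_eq, dif_neg hx]
  have mem : ∀ y x, some x ∈ code y → x ≤ y := by
    intro y
    induction y using wf.induction with
    | _ y ih =>
      intro x hx
      by_cases hy : y = ⊥
      · subst hy
        simp [code_bot] at hx
      · rw [code_eq y hy] at hx
        simp only [List.mem_append, List.mem_singleton, Option.some.injEq] at hx
        rcases hx with hx | rfl
        · exact (ih _ (Order.pred_lt_of_not_isMin (by simpa using hy)) x hx).trans (Order.pred_le y)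
        · exact le_rfl
  refine ⟨code, fun x y => ⟨fun h => ?_, fun h => ?_⟩⟩
  · by_cases hx : x = ⊥
    · simp [hx]
    · exact mem y x (h.subset (by simp [code_eq x hx]))
  · obtain ⟨n, rfl⟩ := h.exists_pred_iterate
    clear h
    induction n with
    | zero => exact List.prefix_rfl
    | succ n ih =>
      refine List.IsPrefix.trans ?_ ih
      rw [Function.iterate_succ_apply']
      by_cases hx : Order.pred^[n] y = ⊥
      · simp [hx]
      · rw [code_eq _ hx]
        exact List.prefix_append _ _

/-- In a colouring of the words over `A`, there is a colour `k` and a copy of the complete tree of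
words of length less than `h k` that has the colour `k`. If the subtree of some letter contains such
a copy for a colour other than that of the root then this copy is good. Otherwise, the root and the
copies in the subtrees form a copy of the colour of the root. -/
theorem exists_monochromatic_words {A : Type u} {N : ℕ} (h : Fin N → ℕ) (c : List A → Fin N) :
    ∃ (k : Fin N) (φ : List A → List A),
      (∀ l, l.length < h k → c (φ l) = k ∧ (φ l).length < ∑ i, h i) ∧
      ∀ l m, l.length < h k → m.length < h k → (φ l <+: φ m ↔ l <+: m) := by
  induction hn : ∑ i, h i generalizing h c with
  | zero =>
    have : h (c []) = 0 := by
      simpa using (Finset.sum_eq_zero_iff.1 hn) (c []) (Finset.mem_univ _)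
    exact ⟨c [], id, by simp [this], by simp [this]⟩
  | succ n ih =>
    -- the empty tree has any colour
    by_cases h₀ : h (c []) = 0
    · exact ⟨c [], id, by simp [h₀], by simp [h₀]⟩
    have hsum : ∑ i, Function.update h (c []) (h (c []) - 1) i = n := by
      have h₁ := Finset.sum_update_of_mem (Finset.mem_univ (c [])) h (h (c []) - 1)
      have h₂ := Finset.add_sum_erase Finset.univ h (Finset.mem_univ (c []))
      rw [Finset.sdiff_singleton_eq_erase] at h₁
      lia
    choose k φ hφ hφ' using fun a : A =>
      ih (Function.update h (c []) (h (c []) - 1)) (fun l => c (a :: l)) hsum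
    by_cases hk : ∃ a, k a ≠ c []
    · obtain ⟨a, ha⟩ := hk
      have hu := Function.update_of_ne ha (h (c []) - 1) h
      refine ⟨k a, fun l => a :: φ a l, fun l hl => ?_, fun l m hl hm => ?_⟩
      · have := hφ a l (by rwa [hu])
        exact ⟨this.1, by simpa using this.2⟩
      · rw [List.cons_prefix_cons, hφ' a l m (by rwa [hu]) (by rwa [hu])]
        simp
    · push Not at hk
      have hu : ∀ a, Function.update h (c []) (h (c []) - 1) (k a) = h (c []) - 1 := fun a => by
        rw [hk a, Function.update_self]
      refine ⟨c [], fun l => match l with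
        | [] => []
        | a :: l => a :: φ a l, fun l hl => ?_, fun l m hl hm => ?_⟩
      · cases l with
        | nil => simp
        | cons a l =>
          rw [List.length_cons] at hl
          have := hφ a l (by rw [hu]; lia)
          exact ⟨this.1.trans (hk a), by simpa using this.2⟩
      · cases l with
        | nil => simp
        | cons a l =>
          cases m with
          | nil => simp
          | cons b m =>
            rw [List.length_cons] at hl hm
            simp only [List.cons_prefix_cons]
            refine and_congr_right ?_
            rintro rfl
            exact hφ' a l m (by rw [hu]; lia) (by rw [hu]; lia)

/-- The comparability graph of a large complete tree contains that of a given tree in a ball, for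
each concentrated distance. Here `n` exceeds the height of the given tree. -/
theorem exists_comparabilityGraph_near {g N n : ℕ} (t : RootedTree.{u}) (code : t → List (Option t))
    (hcode : ∀ x y, code x <+: code y ↔ x ≤ y) (hn : ∀ x, (code x).length < n)
    {d : _ → _ → ℕ∞}
    (hd : IsConcentrated (comparabilityGraph (Words (Option t) (N + N * n))) d g N) :
    ∃ (f : comparabilityGraph t ↪g comparabilityGraph (Words (Option t) (N + N * n))) (w : _),
      ∀ x, d w (f x) ≤ ((2 * g : ℕ) : ℕ∞) := by
  -- two words in a chain are distinguished by all words that branch off the chain between them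
  obtain ⟨a, b, hab, h⟩ := hd.exists_near fun c => ⟨List.replicate c none, by
    rw [List.length_replicate]; lia⟩
  let branch : List (Option t) → List (Option t) := fun l =>
    List.replicate a none ++ some ⊥ :: l
  have hbranch : ∀ l : List (Option t), l.length < N * n → (branch l).length ≤ N + N * n := by
    intro l hl
    simp only [branch, List.length_append, List.length_replicate, List.length_cons]
    lia
  choose c hc using fun (l : List (Option t)) (hl : l.length < N * n) =>
      h ⟨branch l, hbranch l hl⟩ <| by
    have h₁ : List.replicate a none <+: branch l := List.prefix_append _ _
    have h₂ : List.replicate a none ≠ branch l := by simp [branch]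
    have h₃ : ¬ List.replicate b none <+: branch l := by
      intro h
      have := h.getElem (i := a) (by simpa using hab)
      simp [branch] at this
    have h₄ : ¬ branch l <+: List.replicate b none := by
      intro h
      have := h.subset (a := some ⊥) (by simp [branch])
      simp at this
    simp [SimpleGraph.fromRel_adj, Words.le_iff, Words.ext_iff, h₁, h₂, h₃, h₄]
  classical
  -- the words that are too long have an arbitrary colour, since none of them is found
  obtain ⟨k, φ, hφ, hφ'⟩ := exists_monochromatic_words (fun _ => n)
    fun l : List (Option t) => if hl : l.length < N * n then c l hl else a
  have hlen : ∀ x, (φ (code x)).length < N * n := fun x => by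
    simpa using (hφ _ (hn x)).2
  let F : t → Words (Option t) (N + N * n) := fun x => ⟨branch (φ (code x)), hbranch _ (hlen x)⟩
  have hF : ∀ x y, F x ≤ F y ↔ x ≤ y := fun x y => by
    rw [Words.le_iff, List.prefix_append_right_inj, List.cons_prefix_cons,
      hφ' _ _ (hn x) (hn y), hcode]
    simp
  have hinj : Function.Injective F := fun x y hxy =>
    le_antisymm ((hF x y).1 hxy.le) ((hF y x).1 hxy.ge)
  refine ⟨⟨⟨F, hinj⟩, fun {x y} => ?_⟩,
    ⟨List.replicate k none, by rw [List.length_replicate]; lia⟩, fun x => ?_⟩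
  · change (comparabilityGraph _).Adj (F x) (F y) ↔ _
    simp only [SimpleGraph.fromRel_adj, hF, hinj.ne_iff]
  · have := (hφ _ (hn x)).1
    rw [dif_pos (hlen x)] at this
    exact this ▸ (hc _ (hlen x)).trans (by exact_mod_cast by lia)

theorem triviallyPerfectGraphs_isTransductionOf_ballClass {C : GraphClass.{u}}
    (h : IsTransductionOf triviallyPerfectGraphs C) :
    ∃ r, IsTransductionOf triviallyPerfectGraphs (ballClass r C) := by
  refine h.ballClass ?_
  rintro g N W' H' ⟨t, ht, ⟨f'⟩⟩
  obtain ⟨code, hcode⟩ := exists_code t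
  obtain ⟨n, hn⟩ := (Set.finite_range fun x => (code x).length).bddAbove
  refine ⟨_, comparabilityGraph (Words (Option t) (N + N * (n + 1))),
    ⟨Words.tree _ _, inferInstanceAs (Finite (Words _ _)), ⟨SimpleGraph.Iso.refl⟩⟩, fun d hd => ?_⟩
  obtain ⟨f, w, hw⟩ := exists_comparabilityGraph_near t code hcode
    (fun x => Nat.lt_succ_of_le (hn ⟨x, rfl⟩)) hd
  exact ⟨f'.toEmbedding.trans f, w, fun x => hw (f' x)⟩

/-! ### Locality of the monadic properties -/

theorem locally_iff {X C : GraphClass.{u}}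
    (h : IsTransductionOf X C → ∃ r, IsTransductionOf X (ballClass r C)) :
    (∀ r, ¬ IsTransductionOf X (ballClass r C)) ↔ ¬ IsTransductionOf X C :=
  ⟨fun hr hX => (h hX).elim hr, fun hX r hr => hX (hr.trans (ballClass_isTransductionOf r C))⟩

end GraphTransduction

theorem mainTheorem3 (C : GraphTransduction.GraphClass.{u}) :
    (GraphTransduction.LocallyMonadicallyDependent C ↔ GraphTransduction.MonadicallyDependent C) ∧
    (GraphTransduction.LocallyMonadicallyStraight C ↔ GraphTransduction.MonadicallyStraight C) ∧
    (GraphTransduction.LocallyMonadicallyStable C ↔ GraphTransduction.MonadicallyStable C) :=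
by
  open GraphTransduction in
  exact ⟨locally_iff finiteGraphs_isTransductionOf_ballClass,
    locally_iff triviallyPerfectGraphs_isTransductionOf_ballClass,
    locally_iff halfGraphs_isTransductionOf_ballClass⟩
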